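/- Write $\hat f(\xi)=\int_{\mathbb R} f(x)e^{-2\pi i\xi x}\,dx$ for $f\in L^1(\mathbb R)$ and let $\mathbb T=\mathbb R/\mathbb Z$ with its normalized Haar measure. For $1\le p<\infty$, let $M_p(\mathbb R)$ be the space of $m\in L^\infty(\mathbb R)$ for which $T_mf$, defined by $\widehat{T_mf}=m\hat f$ on $L^2\cap L^p(\mathbb R)$, extends to a bounded operator on $L^p(\mathbb R)$, and let $M_p(\mathbb Z)$ be the space of $\phi:\mathbb Z\to\mathbb C$ for which $\widehat{T_\phi f}(n)=\phi(n)\hat f(n)$, $n\in\mathbb Z$, defines a bounded operator on $L^p(\mathbb T)$; $\|m\|_{M_p(\mathbb R)}$ and $\|\phi\|_{M_p(\mathbb Z)}$ denote the operator norms. For $\phi:\mathbb Z\to\mathbb C$ and measurable $\Lambda:\mathbb R\to\mathbb C$ put $$W_{\phi,\Lambda}(\xi)=\sum_{n\in\mathbb Z}\phi(n)\Lambda(\xi-n)=\lim_{N\to\infty}\sum_{|n|\le N}\phi(n)\Lambda(\xi-n),\qquad \delta_\Lambda=\operatorname*{ess\,sup}_{\xi\in\mathbb R}\sum_{n\in\mathbb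 Z}|\Lambda(\xi+n)|\in[0,\infty].$$ Let $S_p$ be the set of measurable $\Lambda$ for which there is a constant $C_{p,\Lambda}<\infty$ such that for every $\phi\in M_p(\mathbb Z)$ the series $W_{\phi,\Lambda}$ converges a.e., $W_{\phi,\Lambda}\in M_p(\mathbb R)$ and $\|W_{\phi,\Lambda}\|_{M_p(\mathbb R)}\le C_{p,\Lambda}\|\phi\|_{M_p(\mathbb Z)}$. Let $S_p^0$ be the set of $\Lambda\in L^\infty(\mathbb R)$ for which there is a constant $C_{p,\Lambda}<\infty$ such that for every finitely supported $\phi\in M_p(\mathbb Z)$ one has $W_{\phi,\Lambda}\in M_p(\mathbb R)$ and $\|W_{\phi,\Lambda}\|_{M_p(\mathbb R)}\le C_{p,\Lambda}\|\phi\|_{M_p(\mathbb Z)}$. Functions equal almost everywhere are identified. **Theorem.** (i) $S_2^0=S_2=\{\Lambda\in L^\infty(\mathbb R):\delta_\Lambda<\infty\}$. (ii) $S_1^0=\{\Lambda\in L^\infty(\mathbb R):\ \Lambda=\hat F\text{ a.e. for some }F\in L^1(\mathbb R)\text{ with }\delta_F<\infty\}$. -/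

import Mathlib

open MeasureTheory Filter Topology
open scoped ENNReal NNReal FourierTransform

namespace SummabilityKernel

/-- `C` bounds the multiplier operator `T_m` on `L^p(ℝ)`: on the dense subspace `L^2 ∩ L^p` the
operator determined by `(T_m f)^ = m f^` (Fourier-Plancherel transform on `L^2`) is defined and
satisfies `‖T_m f‖_p ≤ C ‖f‖_p`. -/
def IsLineBound (p : ℝ≥0∞) (m : ℝ → ℂ) (C : ℝ≥0) : Prop :=
  ∀ f : Lp ℂ 2 (volume : Measure ℝ), MemLp f p volume →
    ∃ g : Lp ℂ 2 (volume : Measure ℝ),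
      (𝓕 g : Lp ℂ 2 (volume : Measure ℝ)) =ᵐ[volume]
        (fun ξ => m ξ * (𝓕 f : Lp ℂ 2 (volume : Measure ℝ)) ξ) ∧
      eLpNorm g p volume ≤ C * eLpNorm f p volume

/-- The multiplier norm `‖m‖_{M_p(ℝ)}`, the operator norm of `T_m` on `L^p(ℝ)`
(`∞` if there is no bound). -/
noncomputable def lineNorm (p : ℝ≥0∞) (m : ℝ → ℂ) : ℝ≥0∞ :=
  ⨅ (C : ℝ≥0) (_ : IsLineBound p m C), (C : ℝ≥0∞)

/-- `M_p(ℝ)`, the Fourier multipliers of `L^p(ℝ)`, for `1 ≤ p < ∞`. As everywhere below, a class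
of functions on `ℝ` is represented by the set of all representatives of its members. -/
def LineMultiplier (p : ℝ≥0∞) : Set (ℝ → ℂ) :=
  {m | MemLp m ∞ volume ∧ lineNorm p m < ∞}

/-- `C` bounds the multiplier operator `T_φ` on `L^p(𝕋)`, `𝕋 = ℝ/ℤ` with its normalized Haar
measure: each `f ∈ L^p` has an image `g ∈ L^p` with Fourier coefficients
`g^(n) = φ(n) f^(n)`, and `‖g‖_p ≤ C ‖f‖_p`. -/
def IsTorusBound (p : ℝ≥0∞) (φ : ℤ → ℂ) (C : ℝ≥0) : Prop :=
  ∀ f : UnitAddCircle → ℂ, MemLp f p AddCircle.haarAddCircle →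
    ∃ g : UnitAddCircle → ℂ, MemLp g p AddCircle.haarAddCircle ∧
      (∀ n : ℤ, fourierCoeff g n = φ n * fourierCoeff f n) ∧
      eLpNorm g p AddCircle.haarAddCircle ≤ C * eLpNorm f p AddCircle.haarAddCircle

/-- The multiplier norm `‖φ‖_{M_p(ℤ)}`, the operator norm of `T_φ` on `L^p(𝕋)`
(`∞` if there is no bound). -/
noncomputable def torusNorm (p : ℝ≥0∞) (φ : ℤ → ℂ) : ℝ≥0∞ :=
  ⨅ (C : ℝ≥0) (_ : IsTorusBound p φ C), (C : ℝ≥0∞)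

/-- `M_p(ℤ)`, the Fourier multipliers of `L^p(𝕋)`, for `1 ≤ p < ∞`. -/
def TorusMultiplier (p : ℝ≥0∞) : Set (ℤ → ℂ) :=
  {φ | torusNorm p φ < ∞}

/-- `S_p(ℝ)`: the (Lebesgue) measurable `Λ` such that, for each `φ ∈ M_p(ℤ)`, the series
`W(ξ) = ∑_{n ∈ ℤ} φ(n) Λ(ξ - n)` converges for a.e. `ξ` (limit of symmetric partial sums),
`W ∈ M_p(ℝ)`, and `‖W‖_{M_p(ℝ)} ≤ C ‖φ‖_{M_p(ℤ)}` with `C` independent of `φ`. -/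
def Kernel (p : ℝ≥0∞) : Set (ℝ → ℂ) :=
  {Λ | AEStronglyMeasurable Λ volume ∧
    ∃ C : ℝ≥0, ∀ φ ∈ TorusMultiplier p, ∃ W : ℝ → ℂ,
      (∀ᵐ ξ : ℝ, Tendsto
        (fun N : ℕ => ∑ n ∈ Finset.Icc (-(N : ℤ)) N, φ n * Λ (ξ - n)) atTop (𝓝 (W ξ))) ∧
      W ∈ LineMultiplier p ∧ lineNorm p W ≤ C * torusNorm p φ}

/-- `S_p^0(ℝ)`: the same requirement for `Λ ∈ L^∞(ℝ)` and finitely supported `φ` only, where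
`W` is a finite sum. -/
def FiniteKernel (p : ℝ≥0∞) : Set (ℝ → ℂ) :=
  {Λ | MemLp Λ ∞ volume ∧
    ∃ C : ℝ≥0, ∀ φ : ℤ →₀ ℂ, ⇑φ ∈ TorusMultiplier p →
      (fun ξ : ℝ => ∑ n ∈ φ.support, φ n * Λ (ξ - n)) ∈ LineMultiplier p ∧
      lineNorm p (fun ξ : ℝ => ∑ n ∈ φ.support, φ n * Λ (ξ - n)) ≤ C * torusNorm p φ}

/-- `δ_Λ = ess sup_ξ ∑_{n ∈ ℤ} |Λ(ξ + n)|`, in `[0, ∞]`. -/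
noncomputable def delta (Λ : ℝ → ℂ) : ℝ≥0∞ :=
  essSup (fun ξ : ℝ => ∑' n : ℤ, ‖Λ (ξ + n)‖ₑ) volume

end SummabilityKernel

namespace SummabilityKernel

/-! For `p = 2`, Plancherel and Parseval turn both multiplier norms into sup norms
(`isLineBound_two`, `IsLineBound.ae_norm_le`, `isTorusBound_two`, `enorm_le_torusNorm`). The kernel
inequality then says that `|∑ φ(n) Λ(ξ - n)| ≤ C sup |φ|` for a.e. `ξ`. There are only countably
many finitely supported `φ` with values in `{-1, 0, 1}`, so one null set serves them all. Off it the
signs may be chosen depending on `ξ`, which bounds the `ℓ¹` norm of the fibre `n ↦ Λ(ξ - n)`.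
Conversely, bounded fibres make the series absolutely convergent.

For `p = 1` and finitely supported `φ`, put `P(x) = ∑ φ(n) e^{2πinx}`. The norm of `φ` in `M_1(ℤ)`
is `‖P‖₁` (`torusNorm_one`). If `Λ = 𝓕 F`, then `∑ φ(n) Λ(ξ - n)` is the transform of `P F`, and
summing over the fibres of `ℝ → 𝕋` gives `‖P F‖₁ ≤ δ_F ‖P‖₁`, which bounds the multiplier norm.

Conversely, the kernel inequality in dual form bounds the pairing of the inverse transform of `Λ`
with `P ψ` by `C ‖P‖₁ ‖ψ‖_∞`. Both norms are translation invariant, so the bound survives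
convolution with a Gaussian (`IsFiniteKernelBound.norm_integral_mollified_le`), which replaces a
distribution by a continuous function `g_j`. Concentrating `P` at a point of `𝕋` and letting `ψ`
carry the conjugate phases of `g_j` on the fibre yields `∑ |g_j(x + n)| ≤ C` for every `x`
(`sum_norm_le_of_pairing`). Hence `‖g_j‖₂ ≤ C` uniformly, so `Λ ∈ L²` by Fatou. A subsequence of
`g_j` converges a.e. to the inverse transform `F` of `Λ`, and the fibre bound passes to `F`. -/

/-! ### The Fourier transform on `L²` and on `L¹` -/

theorem integral_fourierLp_mul (f : Lp ℂ 2 (volume : Measure ℝ)) (ψ : SchwartzMap ℝ ℂ) :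
    ∫ x, (𝓕 f : Lp ℂ 2 (volume : Measure ℝ)) x * ψ x = ∫ x, f x * 𝓕 (ψ : ℝ → ℂ) x := by
  have h := congrArg (fun T => T ψ) (Lp.fourier_toTemperedDistribution_eq f)
  simp only [TemperedDistribution.fourier_apply, Lp.toTemperedDistribution_apply] at h
  rw [SchwartzMap.fourier_coe] at h
  simpa [mul_comm] using h.symm

theorem integral_fourier_mul_swap {f g : ℝ → ℂ} (hf : Integrable f) (hg : Integrable g) :
    ∫ x, 𝓕 f x * g x = ∫ x, f x * 𝓕 g x := by
  have := VectorFourier.integral_fourierIntegral_smul_eq_flip (L := innerₗ ℝ)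
    Real.continuous_fourierChar continuous_inner hf hg (μ := volume) (ν := volume)
  rw [flip_innerₗ] at this
  exact this

theorem integral_fourierInv_mul_swap {f g : ℝ → ℂ} (hf : Integrable f) (hg : Integrable g) :
    ∫ x, 𝓕⁻ f x * g x = ∫ x, f x * 𝓕⁻ g x := by
  rw [Real.fourierInv_eq_fourier_comp_neg f, integral_fourier_mul_swap hf.comp_neg hg,
    ← integral_neg_eq_self]
  simp [Real.fourierInv_eq_fourier_neg]

theorem fourier_fourierInv_coe (ψ : SchwartzMap ℝ ℂ) :
    𝓕 (𝓕⁻ (ψ : ℝ → ℂ)) = ψ := by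
  rw [← SchwartzMap.fourierInv_coe, ← SchwartzMap.fourier_coe]
  simp

theorem ae_eq_of_integral_schwartz_mul {f g : ℝ → ℂ} (hf : LocallyIntegrable f)
    (hg : LocallyIntegrable g)
    (h : ∀ ψ : SchwartzMap ℝ ℂ, ∫ x, f x * ψ x = ∫ x, g x * ψ x) : f =ᵐ[volume] g := by
  refine ae_eq_of_integral_contDiff_smul_eq hf hg fun u hu hc => ?_
  have h1 : HasCompactSupport (Complex.ofRealCLM ∘ u) := hc.comp_left rfl
  have h2 : ContDiff ℝ ((⊤ : ℕ∞) : WithTop ℕ∞) (Complex.ofRealCLM ∘ u) := by fun_prop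
  simpa [mul_comm] using h (h1.toSchwartzMap h2)

/-- Multiplier bounds only provide an `L²` class `g` through its transform; this identifies it with
an explicit `L¹` function. Every Schwartz `ψ` is `𝓕 (𝓕⁻ ψ)`, so the multiplication formulas for `L²`
and `L¹` show that both have the same pairing with `ψ`. -/
theorem ae_eq_of_fourierLp_ae_eq {g : Lp ℂ 2 (volume : Measure ℝ)} {h : ℝ → ℂ} (hh : Integrable h)
    (H : (𝓕 g : Lp ℂ 2 (volume : Measure ℝ)) =ᵐ[volume] 𝓕 h) : g =ᵐ[volume] h := by
  refine ae_eq_of_integral_schwartz_mul ((Lp.memLp g).locallyIntegrable (by norm_num))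
    hh.locallyIntegrable fun ψ => ?_
  rw [← fourier_fourierInv_coe ψ, ← SchwartzMap.fourierInv_coe, ← integral_fourierLp_mul,
    ← integral_fourier_mul_swap hh (𝓕⁻ ψ).integrable]
  refine integral_congr_ae ?_
  filter_upwards [H] with x hx
  rw [hx]

theorem continuous_fourier {h : ℝ → ℂ} (hh : Integrable h) : Continuous (𝓕 h) :=
  VectorFourier.fourierIntegral_continuous Real.continuous_fourierChar
    continuous_inner hh

theorem fourierLp_ae_eq_fourier {f : Lp ℂ 2 (volume : Measure ℝ)} (hf : Integrable f) :
    (𝓕 f : Lp ℂ 2 (volume : Measure ℝ)) =ᵐ[volume] 𝓕 (f : ℝ → ℂ) := by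
  refine ae_eq_of_integral_schwartz_mul ((Lp.memLp _).locallyIntegrable (by norm_num))
    (continuous_fourier hf).locallyIntegrable fun ψ => ?_
  rw [integral_fourierLp_mul, integral_fourier_mul_swap hf ψ.integrable]

theorem norm_fourier_le {h : ℝ → ℂ} (x : ℝ) : ‖𝓕 h x‖ ≤ ∫ y, ‖h y‖ :=
  VectorFourier.norm_fourierIntegral_le_integral_norm _ _ _ _ _

theorem memLp_top_fourier {h : ℝ → ℂ} (hh : Integrable h) : MemLp (𝓕 h) ∞ volume :=
  memLp_top_of_bound (continuous_fourier hh).aestronglyMeasurable _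
    (Eventually.of_forall norm_fourier_le)

/-! ### Elementary properties of the multiplier norms -/

theorem lineNorm_le {p : ℝ≥0∞} {m : ℝ → ℂ} {C : ℝ≥0} (h : IsLineBound p m C) :
    lineNorm p m ≤ C := iInf₂_le C h

theorem IsLineBound.mono {p : ℝ≥0∞} {m : ℝ → ℂ} {C D : ℝ≥0} (h : IsLineBound p m C)
    (hCD : C ≤ D) : IsLineBound p m D := fun f hf => by
  obtain ⟨g, h1, h2⟩ := h f hf
  exact ⟨g, h1, h2.trans (by gcongr)⟩

/-- The infimum is not shown to be attained, hence the strict inequality. It is the source of the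
slack `C + 1` and `B'` in later arguments. -/
theorem isLineBound_of_lineNorm_lt {p : ℝ≥0∞} {m : ℝ → ℂ} {C : ℝ≥0} (h : lineNorm p m < C) :
    IsLineBound p m C := by
  obtain ⟨D, hD, hlt⟩ := by simpa only [lineNorm, iInf_lt_iff] using h
  exact IsLineBound.mono hD (by exact_mod_cast hlt.le)

theorem IsLineBound.congr {p : ℝ≥0∞} {m m' : ℝ → ℂ} {C : ℝ≥0} (h : IsLineBound p m C)
    (hm : m =ᵐ[volume] m') : IsLineBound p m' C := fun f hf => by
  obtain ⟨g, h1, h2⟩ := h f hf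
  refine ⟨g, h1.trans ?_, h2⟩
  filter_upwards [hm] with x hx
  rw [hx]

theorem lineNorm_congr {p : ℝ≥0∞} {m m' : ℝ → ℂ} (hm : m =ᵐ[volume] m') :
    lineNorm p m = lineNorm p m' := by
  unfold lineNorm
  congr! 3 with C
  exact ⟨fun h => h.congr hm, fun h => h.congr hm.symm⟩

theorem lineMultiplier_congr {p : ℝ≥0∞} {m m' : ℝ → ℂ} (hm : m =ᵐ[volume] m')
    (h : m ∈ LineMultiplier p) : m' ∈ LineMultiplier p :=
  ⟨(memLp_congr_ae hm).1 h.1, lineNorm_congr hm ▸ h.2⟩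

theorem torusNorm_le {p : ℝ≥0∞} {φ : ℤ → ℂ} {C : ℝ≥0} (h : IsTorusBound p φ C) :
    torusNorm p φ ≤ C := iInf₂_le C h

theorem le_torusNorm {p : ℝ≥0∞} {φ : ℤ → ℂ} {a : ℝ≥0∞}
    (h : ∀ C : ℝ≥0, IsTorusBound p φ C → a ≤ C) : a ≤ torusNorm p φ := le_iInf₂ h

/-! ### Multipliers of `L²(ℝ)` and of `L²(𝕋)` -/

/-- On `L²(ℝ)` a multiplier that is essentially bounded by `C` is bounded by `C`. -/
theorem isLineBound_two {m : ℝ → ℂ} (hm : AEStronglyMeasurable m volume) {C : ℝ≥0}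
    (h : ∀ᵐ ξ : ℝ, ‖m ξ‖ ≤ C) : IsLineBound 2 m C := by
  intro f _
  have hle : ∀ᵐ ξ : ℝ, ‖m ξ * (𝓕 f : Lp ℂ 2 (volume : Measure ℝ)) ξ‖ ≤
      C * ‖(𝓕 f : Lp ℂ 2 (volume : Measure ℝ)) ξ‖ := by
    filter_upwards [h] with ξ hξ
    rw [norm_mul]
    gcongr
  have hmem : MemLp (fun ξ => m ξ * (𝓕 f : Lp ℂ 2 (volume : Measure ℝ)) ξ) 2 volume :=
    (Lp.memLp (𝓕 f)).of_le_mul (hm.mul (Lp.aestronglyMeasurable _)) hle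
  refine ⟨𝓕⁻ (hmem.toLp _), ?_, ?_⟩
  · rw [FourierTransform.fourier_fourierInv_eq]
    exact hmem.coeFn_toLp
  · have e : ∀ u : Lp ℂ 2 (volume : Measure ℝ), eLpNorm u 2 volume = ‖u‖ₑ := fun u =>
      (Lp.enorm_def u).symm
    have h1 : ‖(𝓕⁻ (hmem.toLp _) : Lp ℂ 2 (volume : Measure ℝ))‖ₑ = ‖hmem.toLp _‖ₑ := by
      rw [← ofReal_norm, ← ofReal_norm, ← Lp.norm_fourier_eq,
        FourierTransform.fourier_fourierInv_eq]
    have h2 : ‖f‖ₑ = ‖(𝓕 f : Lp ℂ 2 (volume : Measure ℝ))‖ₑ := by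
      rw [← ofReal_norm, ← ofReal_norm, Lp.norm_fourier_eq]
    rw [e, e, h1, h2, ← e, ← e, eLpNorm_congr_ae hmem.coeFn_toLp]
    refine (eLpNorm_le_mul_eLpNorm_of_ae_le_mul hle 2).trans ?_
    simp

/-- A multiplier of `L²(ℝ)` with operator bound `C` is essentially bounded by `C`. -/
theorem IsLineBound.ae_norm_le {m : ℝ → ℂ} (hm : AEStronglyMeasurable m volume) {C : ℝ≥0}
    (h : IsLineBound 2 m C) : ∀ᵐ ξ : ℝ, ‖m ξ‖ ≤ C := by
  have key : ∀ u : Lp ℂ 2 (volume : Measure ℝ),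
      eLpNorm (fun ξ => m ξ * u ξ) 2 volume ≤ C * eLpNorm u 2 volume := by
    intro u
    obtain ⟨g, h1, h2⟩ := h (𝓕⁻ u) (Lp.memLp _)
    rw [FourierTransform.fourier_fourierInv_eq] at h1
    have e : ∀ u : Lp ℂ 2 (volume : Measure ℝ), eLpNorm u 2 volume = ‖u‖ₑ := fun u =>
      (Lp.enorm_def u).symm
    have e2 : ∀ v : Lp ℂ 2 (volume : Measure ℝ),
        ‖(𝓕 v : Lp ℂ 2 (volume : Measure ℝ))‖ₑ = ‖v‖ₑ := fun v => by
      rw [← ofReal_norm, ← ofReal_norm, Lp.norm_fourier_eq]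
    rw [← eLpNorm_congr_ae h1, e, e, e2]
    rw [e, e, ← e2 (𝓕⁻ u), FourierTransform.fourier_fourierInv_eq] at h2
    exact h2
  set m' := hm.mk m
  have hm' : Measurable m' := hm.stronglyMeasurable_mk.measurable
  suffices ∀ᵐ ξ : ℝ, ‖m' ξ‖ ≤ C by
    filter_upwards [this, hm.ae_eq_mk] with ξ h1 h2
    rwa [h2]
  have hset : ∀ c : ℝ≥0, C < c → volume {ξ | (c : ℝ) < ‖m' ξ‖} = 0 := by
    intro c hc
    have hmeas : MeasurableSet {ξ | (c : ℝ) < ‖m' ξ‖} :=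
      measurableSet_lt measurable_const hm'.norm
    by_contra hne
    -- A subset of finite positive measure makes the indicator an `L²` function; testing on it
    -- yields `c |s|^{1/2} ≤ C |s|^{1/2}`, against `C < c`.
    obtain ⟨s, hsm, hs, hs0, hsf⟩ :=
      Measure.exists_subset_measure_lt_top hmeas (pos_iff_ne_zero.2 hne)
    have hu := key (indicatorConstLp 2 hsm hsf.ne (1 : ℂ))
    have h1 : eLpNorm (indicatorConstLp 2 hsm hsf.ne (1 : ℂ)) 2 volume
        = volume s ^ (1 / (2 : ℝ)) := by
      rw [eLpNorm_congr_ae indicatorConstLp_coeFn, eLpNorm_indicator_const hsm two_ne_zero ENNReal.ofNat_ne_top]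
      simp
    have h2 : (c : ℝ≥0∞) * volume s ^ (1 / (2 : ℝ)) ≤
        eLpNorm (fun ξ => m ξ * (indicatorConstLp 2 hsm hsf.ne (1 : ℂ)) ξ) 2 volume := by
      have : (c : ℝ≥0∞) * volume s ^ (1 / (2 : ℝ)) =
          eLpNorm (s.indicator fun _ => (c : ℂ)) 2 volume := by
        rw [eLpNorm_indicator_const hsm two_ne_zero ENNReal.ofNat_ne_top]
        simp [enorm_eq_nnnorm]
      rw [this]
      refine eLpNorm_mono_ae ?_
      filter_upwards [indicatorConstLp_coeFn (p := 2) (hs := hsm) (hμs := hsf.ne) (c := (1 : ℂ)),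
        hm.ae_eq_mk] with ξ a b
      rw [a, b]
      by_cases hξ : ξ ∈ s
      · have : (c : ℝ) < ‖m' ξ‖ := hs hξ
        simpa [hξ] using this.le
      · simp [hξ]
    have h3 := h2.trans hu
    rw [h1] at h3
    have h4 : volume s ^ (1 / (2 : ℝ)) ≠ 0 := by simp [hs0.ne']
    have h5 : volume s ^ (1 / (2 : ℝ)) ≠ ∞ := by simp [hsf.ne]
    rw [ENNReal.mul_le_mul_iff_left h4 h5] at h3
    exact absurd (by exact_mod_cast h3 : c ≤ C) (not_le.2 hc)
  have hall : ∀ k : ℕ, ∀ᵐ ξ : ℝ, ‖m' ξ‖ ≤ C + 1 / ((k : ℝ) + 1) := by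
    intro k
    rw [ae_iff]
    simp only [not_le]
    have := hset (C + 1 / ((k : ℝ≥0) + 1)) (lt_add_of_pos_right _ (by positivity))
    simpa using this
  filter_upwards [ae_all_iff.2 hall] with ξ hξ
  exact ge_of_tendsto' (by simpa using tendsto_one_div_add_atTop_nhds_zero_nat.const_add (C : ℝ)) hξ

theorem norm_fourier_apply (n : ℤ) (x : UnitAddCircle) : ‖fourier n x‖ = 1 := by
  rw [fourier_apply, Circle.norm_coe]

theorem enorm_fourier_apply (n : ℤ) (x : UnitAddCircle) : ‖fourier n x‖ₑ = 1 := by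
  rw [← ofReal_norm, norm_fourier_apply, ENNReal.ofReal_one]

theorem enorm_fourierCoeff_le (g : UnitAddCircle → ℂ) (n : ℤ) :
    ‖fourierCoeff g n‖ₑ ≤ eLpNorm g 1 AddCircle.haarAddCircle := by
  rw [eLpNorm_one_eq_lintegral_enorm, fourierCoeff]
  refine (enorm_integral_le_lintegral_enorm _).trans (lintegral_mono fun x => ?_)
  rw [smul_eq_mul, enorm_mul, enorm_fourier_apply, one_mul]

/-- The character `fourier n` is an eigenfunction of `T_φ` with eigenvalue `φ n`, and its `L^p` norm
is at most `1`. -/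
theorem enorm_le_torusNorm {p : ℝ≥0∞} (hp : 1 ≤ p) (φ : ℤ → ℂ) (n : ℤ) :
    ‖φ n‖ₑ ≤ torusNorm p φ := by
  refine le_torusNorm fun C hC => ?_
  obtain ⟨g, h1, h2, h3⟩ := hC (fourier n)
    ((fourier n : C(UnitAddCircle, ℂ)).continuous.memLp_of_hasCompactSupport
      (HasCompactSupport.of_compactSpace _))
  have h4 : fourierCoeff g n = φ n := by
    rw [h2, fourierCoeff_fourier]
    simp
  have h5 : eLpNorm (fourier n : UnitAddCircle → ℂ) p AddCircle.haarAddCircle ≤ 1 := by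
    refine (eLpNorm_le_of_ae_bound (C := 1) (Eventually.of_forall fun x =>
      (norm_fourier_apply n x).le)).trans ?_
    simp
  calc ‖φ n‖ₑ = ‖fourierCoeff g n‖ₑ := by rw [h4]
    _ ≤ eLpNorm g 1 AddCircle.haarAddCircle := enorm_fourierCoeff_le g n
    _ ≤ eLpNorm g p AddCircle.haarAddCircle := eLpNorm_le_eLpNorm_of_exponent_le hp h1.1
    _ ≤ C * 1 := h3.trans (by gcongr)
    _ = C := mul_one _

theorem isTorusBound_two {φ : ℤ → ℂ} {C : ℝ≥0} (h : ∀ n, ‖φ n‖ ≤ C) : IsTorusBound 2 φ C := by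
  intro f hf
  set a := fourierBasis.repr (hf.toLp f) with ha
  have hsum : ∀ s : Finset ℤ, ∑ n ∈ s, ‖φ n * a n‖ ^ (2 : ℝ≥0∞).toReal ≤
      (C * ‖a‖) ^ (2 : ℝ≥0∞).toReal := by
    intro s
    rw [Real.mul_rpow (by positivity) (by positivity)]
    refine le_trans ?_ (mul_le_mul_of_nonneg_left
      (lp.sum_rpow_le_norm_rpow (by simp) a s) (by positivity))
    rw [Finset.mul_sum]
    refine Finset.sum_le_sum fun n _ => ?_
    rw [norm_mul, Real.mul_rpow (by positivity) (by positivity)]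
    gcongr
    exact h n
  let b : lp (fun _ : ℤ => ℂ) 2 := ⟨fun n => φ n * a n, memℓp_gen' hsum⟩
  have hb : ‖b‖ ≤ C * ‖a‖ := lp.norm_le_of_forall_sum_le (by simp) (by positivity) hsum
  refine ⟨fourierBasis.repr.symm b, Lp.memLp _, fun n => ?_, ?_⟩
  · rw [← fourierBasis_repr, LinearIsometryEquiv.apply_symm_apply]
    change φ n * a n = _
    rw [ha, fourierBasis_repr, fourierCoeff_congr_ae hf.coeFn_toLp]
  · rw [← Lp.enorm_def, ← Lp.enorm_toLp hf, ← ofReal_norm, ← ofReal_norm,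
      LinearIsometryEquiv.norm_map, ← LinearIsometryEquiv.norm_map fourierBasis.repr (hf.toLp f),
      ← ENNReal.ofReal_coe_nnreal, ← ENNReal.ofReal_mul (by positivity)]
    exact ENNReal.ofReal_le_ofReal hb

/-! ### The case `p = 2` -/

theorem tendsto_Icc_neg_atTop :
    Tendsto (fun N : ℕ => Finset.Icc (-(N : ℤ)) N) atTop atTop := by
  refine tendsto_atTop_finset_of_monotone (fun a b hab => ?_) fun n => ⟨n.natAbs, ?_⟩
  · exact Finset.Icc_subset_Icc (by lia) (by lia)
  · rw [Finset.mem_Icc]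
    lia

theorem sum_finsupp_cast (φ : ℤ →₀ ℤ) (u : ℤ → ℂ) :
    ∑ n ∈ (φ.mapRange (Int.cast : ℤ → ℂ) Int.cast_zero).support,
      (φ.mapRange (Int.cast : ℤ → ℂ) Int.cast_zero) n * u n = ∑ n ∈ φ.support, (φ n : ℂ) * u n := by
  refine Finset.sum_subset Finsupp.support_mapRange fun n _ hn => ?_
  simp only [Finsupp.mem_support_iff, not_not] at hn
  rw [hn, zero_mul]

/-- The choice `φ = sign u` on `s` and `0` elsewhere turns the tested sum into `∑ |u n|`. Integer
values keep the set of test sequences countable. -/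
theorem sum_abs_le_of_forall_sign {u : ℤ → ℝ} {B : ℝ}
    (h : ∀ φ : ℤ →₀ ℤ, (∀ n, |φ n| ≤ 1) → |∑ n ∈ φ.support, (φ n : ℝ) * u n| ≤ B)
    (s : Finset ℤ) : ∑ n ∈ s, |u n| ≤ B := by
  classical
  let φ : ℤ →₀ ℤ := Finsupp.onFinset s (fun n => if n ∈ s then (SignType.sign (u n) : ℤ) else 0)
    fun n hn => by by_contra hc; simp [hc] at hn
  have h1 : ∀ n, |φ n| ≤ 1 := by
    intro n
    change |if n ∈ s then (SignType.sign (u n) : ℤ) else 0| ≤ 1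
    split_ifs
    · cases SignType.sign (u n) <;> simp
    · simp
  have h2 : ∑ n ∈ φ.support, (φ n : ℝ) * u n = ∑ n ∈ s, |u n| := by
    rw [Finset.sum_subset (Finsupp.support_onFinset_subset : φ.support ⊆ s)]
    · refine Finset.sum_congr rfl fun n hn => ?_
      have : φ n = (SignType.sign (u n) : ℤ) := if_pos hn
      rw [this, ← sign_mul_self (u n)]
      rcases lt_trichotomy (u n) 0 with hu | hu | hu <;> simp [hu]
    · intro n _ hn
      simp only [Finsupp.mem_support_iff, not_not] at hn
      rw [hn, Int.cast_zero, zero_mul]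
  rw [← h2]
  exact (le_abs_self _).trans (h φ h1)

theorem finiteKernel_two_subset :
    FiniteKernel 2 ⊆ {Λ : ℝ → ℂ | MemLp Λ ∞ volume ∧ delta Λ < ∞} := by
  rintro Λ ⟨hΛ, C, hC⟩
  refine ⟨hΛ, ?_⟩
  have hae : ∀ φ : ℤ →₀ ℤ, (∀ n, |φ n| ≤ 1) →
      ∀ᵐ ξ : ℝ, ‖∑ n ∈ φ.support, (φ n : ℂ) * Λ (ξ - n)‖ ≤ (C + 1 : ℝ≥0) := by
    intro φ hφ
    set ψ := φ.mapRange (Int.cast : ℤ → ℂ) Int.cast_zero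
    have hψ : IsTorusBound 2 ψ 1 := isTorusBound_two fun n => by
      have : |(φ n : ℝ)| ≤ 1 := by exact_mod_cast hφ n
      simpa [ψ] using this
    have h1 : torusNorm 2 ψ ≤ 1 := by simpa using torusNorm_le hψ
    obtain ⟨h2, h3⟩ := hC ψ (h1.trans_lt ENNReal.one_lt_top)
    have h4 : lineNorm 2 (fun ξ : ℝ => ∑ n ∈ ψ.support, ψ n * Λ (ξ - n)) < (C + 1 : ℝ≥0) := by
      refine h3.trans_lt ((mul_le_mul_right h1 _).trans_lt ?_)
      rw [mul_one]
      exact_mod_cast lt_add_one C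
    have h5 := (isLineBound_of_lineNorm_lt h4).ae_norm_le h2.1.1
    simpa only [ψ, sum_finsupp_cast φ] using h5
  have hall : ∀ᵐ ξ : ℝ, ∀ φ : ℤ →₀ ℤ, (∀ n, |φ n| ≤ 1) →
      ‖∑ n ∈ φ.support, (φ n : ℂ) * Λ (ξ - n)‖ ≤ (C + 1 : ℝ≥0) := by
    -- `ℤ →₀ ℤ` is countable, so the exceptional null sets can be united before the signs are chosen
    -- as functions of `ξ`.
    rw [ae_all_iff]
    intro φ
    by_cases h : ∀ n, |φ n| ≤ 1
    · filter_upwards [hae φ h] with ξ hξ _ using hξ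
    · exact Eventually.of_forall fun ξ h' => absurd h' h
  -- The factor `2` arises because real and imaginary parts are tested separately by real signs.
  refine (essSup_le_of_ae_le ((2 * (C + 1) : ℝ≥0) : ℝ≥0∞) ?_).trans_lt ENNReal.coe_lt_top
  filter_upwards [hall] with ξ hξ
  rw [← (Equiv.neg ℤ).tsum_eq]
  refine ENNReal.summable.tsum_le_of_sum_le fun s => ?_
  have hre : ∑ n ∈ s, |(Λ (ξ - n)).re| ≤ (C + 1 : ℝ≥0) := by
    refine sum_abs_le_of_forall_sign (fun φ hφ => ?_) s
    refine le_trans (le_of_eq ?_) ((Complex.abs_re_le_norm _).trans (hξ φ hφ))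
    simp [Complex.re_sum]
  have him : ∑ n ∈ s, |(Λ (ξ - n)).im| ≤ (C + 1 : ℝ≥0) := by
    refine sum_abs_le_of_forall_sign (fun φ hφ => ?_) s
    refine le_trans (le_of_eq ?_) ((Complex.abs_im_le_norm _).trans (hξ φ hφ))
    simp [Complex.im_sum]
  have hsum : ∑ n ∈ s, ‖Λ (ξ - n)‖ ≤ (2 * (C + 1 : ℝ≥0) : ℝ≥0) := by
    calc ∑ n ∈ s, ‖Λ (ξ - n)‖ ≤ ∑ n ∈ s, (|(Λ (ξ - n)).re| + |(Λ (ξ - n)).im|) :=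
          Finset.sum_le_sum fun n _ => Complex.norm_le_abs_re_add_abs_im _
      _ ≤ (2 * (C + 1 : ℝ≥0) : ℝ≥0) := by
          rw [Finset.sum_add_distrib]
          push_cast at *
          linarith
  have : ∑ n ∈ s, ‖Λ (ξ - n)‖₊ ≤ 2 * (C + 1) := by
    rw [← NNReal.coe_le_coe, NNReal.coe_sum]
    exact hsum
  simp only [Equiv.neg_apply, Int.cast_neg, ← sub_eq_add_neg, enorm_eq_nnnorm]
  exact_mod_cast this

theorem delta_ae_le (Λ : ℝ → ℂ) : ∀ᵐ ξ : ℝ, ∑' n : ℤ, ‖Λ (ξ + n)‖ₑ ≤ delta Λ :=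
  ae_le_essSup

theorem quasiMeasurePreserving_sub_const (a : ℝ) :
    Measure.QuasiMeasurePreserving (fun ξ : ℝ => ξ - a) volume volume :=
  (measurePreserving_sub_right volume a).quasiMeasurePreserving

/-- Since `|φ| ≤ B`, almost every fibre series is dominated by `B ∑ |Λ(ξ - n)| ≤ D B`, which gives
convergence and the sup bound together. -/
theorem subset_kernel_two :
    {Λ : ℝ → ℂ | MemLp Λ ∞ volume ∧ delta Λ < ∞} ⊆ Kernel 2 := by
  rintro Λ ⟨hΛ, hδ⟩
  lift delta Λ to ℝ≥0 using hδ.ne with D hD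
  refine ⟨hΛ.1, D, fun φ hφ => ?_⟩
  have hφ' : torusNorm 2 φ < ∞ := hφ
  lift torusNorm 2 φ to ℝ≥0 using hφ'.ne with B hB
  have hb : ∀ n, ‖φ n‖ ≤ B := fun n => by
    have := enorm_le_torusNorm (p := 2) (by norm_num) φ n
    rw [← hB, enorm_eq_nnnorm] at this
    exact_mod_cast this
  have hs : ∀ᵐ ξ : ℝ, Summable (fun n : ℤ => ‖Λ (ξ - n)‖) ∧ ∑' n : ℤ, ‖Λ (ξ - n)‖ ≤ D := by
    filter_upwards [delta_ae_le Λ] with ξ hξ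
    rw [← (Equiv.neg ℤ).tsum_eq, ← hD] at hξ
    simp only [Equiv.neg_apply, Int.cast_neg, ← sub_eq_add_neg] at hξ
    have hsum : Summable (fun n : ℤ => ‖Λ (ξ - n)‖₊) := by
      rw [← ENNReal.tsum_coe_ne_top_iff_summable]
      exact ne_top_of_le_ne_top ENNReal.coe_ne_top hξ
    refine ⟨NNReal.summable_coe.2 hsum, ?_⟩
    simp only [enorm_eq_nnnorm] at hξ
    rw [← ENNReal.coe_tsum hsum] at hξ
    have : ∑' n : ℤ, ‖Λ (ξ - n)‖₊ ≤ D := by exact_mod_cast hξ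
    simp only [← coe_nnnorm]
    rw [← NNReal.coe_tsum]
    exact_mod_cast this
  have hlim : ∀ᵐ ξ : ℝ, Tendsto
      (fun N : ℕ => ∑ n ∈ Finset.Icc (-(N : ℤ)) N, φ n * Λ (ξ - n)) atTop
        (𝓝 (∑' n : ℤ, φ n * Λ (ξ - n))) ∧ ‖∑' n : ℤ, φ n * Λ (ξ - n)‖ ≤ (D * B : ℝ≥0) := by
    filter_upwards [hs] with ξ hξ
    have hle : ∀ n : ℤ, ‖φ n * Λ (ξ - n)‖ ≤ B * ‖Λ (ξ - n)‖ := fun n => by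
      rw [norm_mul]
      gcongr
      exact hb n
    have h1 : Summable (fun n : ℤ => φ n * Λ (ξ - n)) :=
      Summable.of_norm_bounded (hξ.1.mul_left _) hle
    refine ⟨h1.hasSum.comp tendsto_Icc_neg_atTop, ?_⟩
    refine (tsum_of_norm_bounded (hξ.1.mul_left (B : ℝ)).hasSum hle).trans ?_
    rw [tsum_mul_left, mul_comm]
    push_cast
    gcongr
    exact hξ.2
  have hmeas : AEStronglyMeasurable (fun ξ : ℝ => ∑' n : ℤ, φ n * Λ (ξ - n)) volume := by
    refine aestronglyMeasurable_of_tendsto_ae atTop (fun N : ℕ => ?_) (hlim.mono fun ξ h => h.1)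
    refine Finset.aestronglyMeasurable_fun_sum _ fun n _ => AEStronglyMeasurable.const_mul ?_ _
    exact hΛ.1.comp_quasiMeasurePreserving (quasiMeasurePreserving_sub_const _)
  have hbd := hlim.mono fun ξ h => h.2
  have hline : lineNorm 2 (fun ξ : ℝ => ∑' n : ℤ, φ n * Λ (ξ - n)) ≤ (D * B : ℝ≥0) :=
    lineNorm_le (isLineBound_two hmeas hbd)
  refine ⟨fun ξ => ∑' n : ℤ, φ n * Λ (ξ - n), hlim.mono fun ξ h => h.1,
    ⟨memLp_top_of_bound hmeas _ hbd, hline.trans_lt ENNReal.coe_lt_top⟩, ?_⟩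
  exact_mod_cast hline

theorem tendsto_symmetric_sum_finsupp (φ : ℤ →₀ ℂ) (u : ℤ → ℂ) :
    Tendsto (fun N : ℕ => ∑ n ∈ Finset.Icc (-(N : ℤ)) N, φ n * u n) atTop
      (𝓝 (∑ n ∈ φ.support, φ n * u n)) := by
  have : HasSum (fun n => φ n * u n) (∑ n ∈ φ.support, φ n * u n) :=
    hasSum_sum_of_ne_finset_zero fun n hn => by
      rw [Finsupp.notMem_support_iff.1 hn, zero_mul]
  exact this.comp tendsto_Icc_neg_atTop

theorem kernel_two_subset_finiteKernel : Kernel 2 ⊆ FiniteKernel 2 := by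
  rintro Λ ⟨hΛ, C, hC⟩
  have key : ∀ φ : ℤ →₀ ℂ, ⇑φ ∈ TorusMultiplier 2 →
      (fun ξ : ℝ => ∑ n ∈ φ.support, φ n * Λ (ξ - n)) ∈ LineMultiplier 2 ∧
      lineNorm 2 (fun ξ : ℝ => ∑ n ∈ φ.support, φ n * Λ (ξ - n)) ≤ C * torusNorm 2 φ := by
    intro φ hφ
    obtain ⟨W, h1, h2, h3⟩ := hC φ hφ
    have hW : W =ᵐ[volume] fun ξ : ℝ => ∑ n ∈ φ.support, φ n * Λ (ξ - n) := by
      filter_upwards [h1] with ξ hξ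
      exact tendsto_nhds_unique hξ (tendsto_symmetric_sum_finsupp φ fun n => Λ (ξ - n))
    exact ⟨lineMultiplier_congr hW h2, lineNorm_congr hW ▸ h3⟩
  refine ⟨?_, C, key⟩
  -- For the unit mass at `0` the series is `Λ` itself, so boundedness of `Λ` is part of the kernel
  -- condition.
  have hone : ⇑(Finsupp.single (0 : ℤ) (1 : ℂ)) ∈ TorusMultiplier 2 := by
    have : IsTorusBound 2 (Finsupp.single (0 : ℤ) (1 : ℂ)) 1 := isTorusBound_two fun n => by
      rw [Finsupp.single_apply]
      split_ifs <;> simp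
    exact (torusNorm_le this).trans_lt ENNReal.coe_lt_top
  simpa [Finsupp.support_single] using (key _ hone).1.1

theorem two_eq : FiniteKernel 2 = Kernel 2 ∧
    Kernel 2 = {Λ : ℝ → ℂ | MemLp Λ ∞ volume ∧ delta Λ < ∞} :=
  ⟨(finiteKernel_two_subset.trans subset_kernel_two).antisymm kernel_two_subset_finiteKernel,
    (kernel_two_subset_finiteKernel.trans finiteKernel_two_subset).antisymm subset_kernel_two⟩

/-! ### Trigonometric polynomials and convolution on the circle -/

/-- The trigonometric polynomial on the circle with coefficients `φ`. -/
noncomputable def trigPoly (φ : ℤ →₀ ℂ) : C(UnitAddCircle, ℂ) :=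
  φ.sum fun n a => a • fourier n

theorem trigPoly_apply (φ : ℤ →₀ ℂ) (x : UnitAddCircle) :
    trigPoly φ x = ∑ n ∈ φ.support, φ n * fourier n x := by
  simp [trigPoly, Finsupp.sum, ContinuousMap.sum_apply]

theorem trigPoly_apply_of_subset {φ : ℤ →₀ ℂ} {s : Finset ℤ} (hs : φ.support ⊆ s)
    (x : UnitAddCircle) : trigPoly φ x = ∑ n ∈ s, φ n * fourier n x := by
  rw [trigPoly_apply]
  refine Finset.sum_subset hs fun n _ hn => ?_
  rw [Finsupp.notMem_support_iff.1 hn, zero_mul]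

theorem exists_trigPoly_eq_iff {q : C(UnitAddCircle, ℂ)} :
    (∃ φ, trigPoly φ = q) ↔ q ∈ Submodule.span ℂ (Set.range (@fourier 1)) := by
  rw [Finsupp.mem_span_range_iff_exists_finsupp]
  rfl

/-- The `L¹` norm of a trigonometric polynomial. -/
noncomputable def trigNorm (φ : ℤ →₀ ℂ) : ℝ≥0∞ :=
  ∫⁻ x, ‖trigPoly φ x‖ₑ ∂AddCircle.haarAddCircle

theorem integrable_circle (q : C(UnitAddCircle, ℂ)) :
    Integrable q AddCircle.haarAddCircle :=
  q.continuous.integrable_of_hasCompactSupport (HasCompactSupport.of_compactSpace _)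

theorem trigNorm_lt_top (φ : ℤ →₀ ℂ) : trigNorm φ < ∞ :=
  (integrable_circle (trigPoly φ)).2

theorem integral_trigPoly_mul (φ : ℤ →₀ ℂ) {g : UnitAddCircle → ℂ}
    (hg : Integrable g AddCircle.haarAddCircle) :
    ∫ x, trigPoly φ x * g x ∂AddCircle.haarAddCircle =
      ∑ n ∈ φ.support, φ n * fourierCoeff g (-n) := by
  simp_rw [trigPoly_apply, Finset.sum_mul, mul_assoc]
  rw [integral_finsetSum]
  · refine Finset.sum_congr rfl fun n _ => ?_
    rw [integral_const_mul, fourierCoeff, neg_neg]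
    rfl
  · intro n _
    have := hg.fourier_smul n
    exact Integrable.const_mul this _

theorem fourierCoeff_trigPoly (φ : ℤ →₀ ℂ) (n : ℤ) :
    fourierCoeff (trigPoly φ) n = φ n := by
  classical
  have h := integral_trigPoly_mul φ (integrable_circle (fourier (-n)))
  simp_rw [fourierCoeff_fourier] at h
  rw [fourierCoeff]
  simp_rw [smul_eq_mul, mul_comm (fourier (-n) _), h]
  rw [Finset.sum_eq_single n]
  · simp
  · intro m _ hm
    rw [Pi.single_eq_of_ne (by simpa using hm), mul_zero]
  · intro hn
    rw [Finsupp.notMem_support_iff.1 hn, zero_mul]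

theorem fourier_mul_fourier_sub (n : ℤ) (x y : UnitAddCircle) :
    fourier (-n) y * fourier n x = fourier n (x - y) := by
  simp only [fourier_apply, sub_eq_add_neg, smul_add, smul_neg, neg_smul, AddCircle.toCircle_add,
    Circle.coe_mul, mul_comm]

/-- `T_φ f` is the convolution of `f` with `trigPoly φ`; Tonelli and translation invariance bound
its `L¹` norm. -/
theorem isTorusBound_one (φ : ℤ →₀ ℂ) : IsTorusBound 1 φ (trigNorm φ).toNNReal := by
  intro f hf
  have hfi := memLp_one_iff_integrable.1 hf
  set ψ : ℤ →₀ ℂ := Finsupp.onFinset φ.support (fun n => φ n * fourierCoeff f n) fun n hn => by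
    rw [Finsupp.mem_support_iff]
    exact left_ne_zero_of_mul hn
  have hψ : ∀ n, ψ n = φ n * fourierCoeff f n := fun n => rfl
  refine ⟨trigPoly ψ, memLp_one_iff_integrable.2 (integrable_circle _), fun n => ?_, ?_⟩
  · rw [fourierCoeff_trigPoly, hψ]
  rw [ENNReal.coe_toNNReal (trigNorm_lt_top φ).ne, eLpNorm_one_eq_lintegral_enorm,
    eLpNorm_one_eq_lintegral_enorm]
  have hconv : ∀ x, trigPoly ψ x = ∫ y, f y * trigPoly φ (x - y) ∂AddCircle.haarAddCircle := by
    intro x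
    simp_rw [trigPoly_apply φ, Finset.mul_sum]
    rw [trigPoly_apply_of_subset Finsupp.support_onFinset_subset, integral_finsetSum]
    · refine Finset.sum_congr rfl fun n _ => ?_
      rw [hψ, fourierCoeff, mul_assoc, ← integral_mul_const, ← integral_const_mul]
      refine integral_congr_ae (Eventually.of_forall fun y => ?_)
      simp only [← fourier_mul_fourier_sub, smul_eq_mul]
      ring
    · intro n _
      have := ((hfi.fourier_smul (-n)).const_mul (φ n)).mul_const (fourier n x)
      refine this.congr (Eventually.of_forall fun y => ?_)
      simp only [← fourier_mul_fourier_sub, smul_eq_mul]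
      ring
  calc ∫⁻ x, ‖trigPoly ψ x‖ₑ ∂AddCircle.haarAddCircle
      ≤ ∫⁻ x, ∫⁻ y, ‖f y‖ₑ * ‖trigPoly φ (x - y)‖ₑ ∂AddCircle.haarAddCircle
          ∂AddCircle.haarAddCircle := by
        refine lintegral_mono fun x => ?_
        rw [hconv]
        refine (enorm_integral_le_lintegral_enorm _).trans (lintegral_mono fun y => ?_)
        rw [enorm_mul]
    _ = ∫⁻ y, ∫⁻ x, ‖f y‖ₑ * ‖trigPoly φ (x - y)‖ₑ ∂AddCircle.haarAddCircle
          ∂AddCircle.haarAddCircle := by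
        refine lintegral_lintegral_swap ?_
        refine AEMeasurable.mul (hf.1.enorm.comp_snd) ?_
        refine Measurable.aemeasurable ?_
        have : Continuous (fun z : UnitAddCircle × UnitAddCircle => trigPoly φ (z.1 - z.2)) :=
          (trigPoly φ).continuous.comp (continuous_fst.sub continuous_snd)
        exact this.enorm.measurable
    _ = ∫⁻ y, ‖f y‖ₑ * trigNorm φ ∂AddCircle.haarAddCircle := by
        refine lintegral_congr fun y => ?_
        rw [lintegral_const_mul' _ _ enorm_ne_top,
          lintegral_sub_right_eq_self (fun x => ‖trigPoly φ x‖ₑ) y, trigNorm]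
    _ = trigNorm φ * ∫⁻ y, ‖f y‖ₑ ∂AddCircle.haarAddCircle := by
        rw [lintegral_mul_const' _ _ (trigNorm_lt_top φ).ne, mul_comm]

/-! ### Peaking polynomials and the norm of `M_1(ℤ)` -/

/-- A nonnegative trigonometric polynomial of degree one with its strict maximum `1` at `0`. -/
noncomputable def peak (x : UnitAddCircle) : ℝ := (1 + (fourier 1 x).re) / 2

theorem continuous_peak : Continuous peak := by
  unfold peak
  fun_prop

theorem peak_nonneg (x : UnitAddCircle) : 0 ≤ peak x := by
  have := (abs_le.1 (Complex.abs_re_le_norm (fourier 1 x))).1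
  rw [norm_fourier_apply] at this
  unfold peak
  linarith

theorem peak_zero : peak 0 = 1 := by
  rw [peak, fourier_eval_zero]
  norm_num

theorem peak_lt_one {x : UnitAddCircle} (hx : x ≠ 0) : peak x < 1 := by
  have h1 := (abs_le.1 (Complex.abs_re_le_norm (fourier 1 x))).2
  rw [norm_fourier_apply] at h1
  have h2 : (fourier 1 x).re ≠ 1 := by
    intro h
    apply hx
    apply AddCircle.injective_toCircle (T := 1) one_ne_zero
    rw [AddCircle.toCircle_zero]
    apply Circle.ext
    have h3 : (fourier 1 x).im = 0 := by
      have := Complex.sq_norm (fourier 1 x)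
      rw [norm_fourier_apply, Complex.normSq_apply, h] at this
      have : (fourier 1 x).im * (fourier 1 x).im = 0 := by linarith
      exact mul_self_eq_zero.1 this
    rw [← fourier_one]
    exact Complex.ext (by simpa using h) (by simpa using h3)
  have := lt_of_le_of_ne h1 h2
  unfold peak
  linarith

theorem exists_trigPoly_peak (x₀ : UnitAddCircle) (N : ℕ) :
    ∃ φ : ℤ →₀ ℂ, ∀ x, trigPoly φ x = ((peak (x - x₀) ^ N : ℝ) : ℂ) := by
  -- `q` is `peak (x - x₀)` expanded in the characters of frequency `-1, 0, 1`; its powers stay in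
  -- the algebra they generate.
  let q : C(UnitAddCircle, ℂ) := (1 / 2 : ℂ) • 1 + (fourier (-1) x₀ / 4) • fourier 1 +
    (fourier 1 x₀ / 4) • fourier (-1)
  have hmem : ∀ n, (fourier n : C(UnitAddCircle, ℂ)) ∈ fourierSubalgebra (T := 1) := fun n => by
    have : (fourier n : C(UnitAddCircle, ℂ)) ∈ Submodule.span ℂ (Set.range (@fourier 1)) :=
      Submodule.subset_span ⟨n, rfl⟩
    rwa [← fourierSubalgebra_coe] at this
  have hq : q ∈ fourierSubalgebra (T := 1) :=
    add_mem (add_mem (Subalgebra.smul_mem _ (one_mem _) _) (Subalgebra.smul_mem _ (hmem _) _))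
      (Subalgebra.smul_mem _ (hmem _) _)
  have hqN : q ^ N ∈ Submodule.span ℂ (Set.range (@fourier 1)) := by
    rw [← fourierSubalgebra_coe]
    exact pow_mem hq N
  obtain ⟨φ, hφ⟩ := exists_trigPoly_eq_iff.2 hqN
  refine ⟨φ, fun x => ?_⟩
  rw [hφ, ContinuousMap.pow_apply]
  push_cast
  congr 1
  have hre : (((fourier 1 (x - x₀)).re : ℝ) : ℂ) =
      (fourier 1 (x - x₀) + fourier (-1) (x - x₀)) / 2 := by
    rw [fourier_neg, Complex.re_eq_add_conj]
  have h2 := fourier_mul_fourier_sub 1 x x₀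
  have h3 := fourier_mul_fourier_sub (-1) x x₀
  rw [neg_neg] at h3
  simp only [q, peak, ContinuousMap.add_apply, ContinuousMap.smul_apply, ContinuousMap.one_apply,
    smul_eq_mul]
  push_cast
  rw [hre, ← h2, ← h3]
  ring

theorem tendsto_peak_pow {g : UnitAddCircle → ℂ} (hg : Continuous g) :
    Tendsto (fun N : ℕ => (∫ x, peak x ^ N ∂AddCircle.haarAddCircle)⁻¹ •
      ∫ x, peak x ^ N • g x ∂AddCircle.haarAddCircle) atTop (𝓝 (g 0)) := by
  have := tendsto_setIntegral_pow_smul_of_unique_maximum_of_isCompact_of_measure_nhdsWithin_pos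
    (μ := (AddCircle.haarAddCircle : Measure UnitAddCircle)) (s := Set.univ) (x₀ := 0) (c := peak)
    (g := g) isCompact_univ (fun u hu h0 => by
      rw [Set.inter_univ]
      exact hu.measure_pos _ ⟨0, h0⟩) continuous_peak.continuousOn
    (fun y _ hy => by rw [peak_zero]; exact peak_lt_one hy) (fun x _ => peak_nonneg x)
    (by rw [peak_zero]; exact one_pos) (Set.mem_univ _)
    (by
      rw [integrableOn_univ]
      exact hg.integrable_of_hasCompactSupport (HasCompactSupport.of_compactSpace _))
    hg.continuousWithinAt
  simpa using this

theorem integral_peak_pow_pos (N : ℕ) : 0 < ∫ x, peak x ^ N ∂AddCircle.haarAddCircle := by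
  have hc : Continuous fun x => peak x ^ N := continuous_peak.pow N
  refine hc.integral_pos_of_hasCompactSupport_nonneg_nonzero
    (HasCompactSupport.of_compactSpace _) (fun x => pow_nonneg (peak_nonneg x) N) (x := 0) ?_
  simp [peak_zero]

/-- Normalised powers of `peak` have `L¹` norm `1` and Fourier coefficients tending to `1`. Their
images under `T_φ` have norm at most `C` and coefficients tending to those of `trigPoly φ`, and
pairing with `trigPoly ψ` sees only finitely many coefficients. -/
theorem IsTorusBound.norm_integral_trigPoly_le {φ : ℤ →₀ ℂ} {C : ℝ≥0} (h : IsTorusBound 1 φ C)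
    (ψ : ℤ →₀ ℂ) :
    ‖∫ x, trigPoly ψ x * trigPoly φ x ∂AddCircle.haarAddCircle‖ ≤ C * ‖trigPoly ψ‖ := by
  set I : ℕ → ℝ := fun N => ∫ x, peak x ^ N ∂AddCircle.haarAddCircle with hI
  have hIpos : ∀ N, 0 < I N := integral_peak_pow_pos
  let f : ℕ → C(UnitAddCircle, ℂ) := fun N =>
    ⟨fun x => (((I N)⁻¹ * peak x ^ N : ℝ) : ℂ), Complex.continuous_ofReal.comp
      (continuous_const.mul (continuous_peak.pow N))⟩
  have hf : ∀ N x, f N x = (((I N)⁻¹ * peak x ^ N : ℝ) : ℂ) := fun N x => rfl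
  have hfn : ∀ N, eLpNorm (f N) 1 AddCircle.haarAddCircle = 1 := by
    intro N
    rw [eLpNorm_one_eq_lintegral_enorm, ← ofReal_integral_norm_eq_lintegral_enorm
      (integrable_circle _)]
    have : ∀ x, ‖f N x‖ = (I N)⁻¹ * peak x ^ N := fun x => by
      rw [hf, Complex.norm_real, Real.norm_of_nonneg]
      have := hIpos N
      have := peak_nonneg x
      positivity
    simp_rw [this]
    rw [integral_const_mul, inv_mul_cancel₀ (hIpos N).ne', ENNReal.ofReal_one]
  have hcoef : ∀ n : ℤ, Tendsto (fun N => fourierCoeff (f N) n) atTop (𝓝 1) := by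
    intro n
    have := tendsto_peak_pow (g := fourier (-n)) (fourier (-n)).continuous
    rw [fourier_eval_zero] at this
    refine this.congr fun N => ?_
    rw [← integral_smul, fourierCoeff]
    refine integral_congr_ae (Eventually.of_forall fun x => ?_)
    simp only [hf, smul_eq_mul, Complex.real_smul]
    push_cast
    ring
  choose g hg1 hg2 hg3 using fun N => h (f N) (memLp_one_iff_integrable.2 (integrable_circle _))
  have hgi := fun N => memLp_one_iff_integrable.1 (hg1 N)
  have hlim : Tendsto (fun N => ∫ x, trigPoly ψ x * g N x ∂AddCircle.haarAddCircle) atTop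
      (𝓝 (∫ x, trigPoly ψ x * trigPoly φ x ∂AddCircle.haarAddCircle)) := by
    rw [integral_trigPoly_mul ψ (integrable_circle _)]
    refine Tendsto.congr (fun N => (integral_trigPoly_mul ψ (hgi N)).symm) ?_
    refine tendsto_finsetSum _ fun n _ => Tendsto.const_mul _ ?_
    simp_rw [hg2, fourierCoeff_trigPoly]
    simpa using (hcoef (-n)).const_mul (φ (-n))
  refine le_of_tendsto' hlim.norm fun N => ?_
  have hgN : ∫ x, ‖g N x‖ ∂AddCircle.haarAddCircle ≤ C := by
    have := hg3 N
    rw [hfn, mul_one, eLpNorm_one_eq_lintegral_enorm,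
      ← ofReal_integral_norm_eq_lintegral_enorm (hgi N)] at this
    rwa [ENNReal.ofReal_le_coe] at this
  calc ‖∫ x, trigPoly ψ x * g N x ∂AddCircle.haarAddCircle‖
      ≤ ∫ x, ‖trigPoly ψ‖ * ‖g N x‖ ∂AddCircle.haarAddCircle := by
        refine norm_integral_le_of_norm_le ((hgi N).norm.const_mul _)
          (Eventually.of_forall fun x => ?_)
        rw [norm_mul]
        gcongr
        exact (trigPoly ψ).norm_coe_le_norm x
    _ ≤ C * ‖trigPoly ψ‖ := by
        rw [integral_const_mul, mul_comm]
        gcongr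

theorem IsTorusBound.norm_integral_mul_trigPoly_le {φ : ℤ →₀ ℂ} {C : ℝ≥0}
    (h : IsTorusBound 1 φ C) (q : C(UnitAddCircle, ℂ)) :
    ‖∫ x, q x * trigPoly φ x ∂AddCircle.haarAddCircle‖ ≤ C * ‖q‖ := by
  have hq : q ∈ (Submodule.span ℂ (Set.range (@fourier 1))).topologicalClosure := by
    rw [span_fourier_closure_eq_top]
    trivial
  obtain ⟨u, hu, hlim⟩ := mem_closure_iff_seq_limit.1 hq
  choose ψ hψ using fun N => exists_trigPoly_eq_iff.2 (hu N)
  have hint : Tendsto (fun N => ∫ x, u N x * trigPoly φ x ∂AddCircle.haarAddCircle) atTop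
      (𝓝 (∫ x, q x * trigPoly φ x ∂AddCircle.haarAddCircle)) := by
    obtain ⟨M, hM⟩ := hlim.norm.bddAbove_range
    refine tendsto_integral_of_dominated_convergence (fun x => M * ‖trigPoly φ x‖)
      (fun N => ((u N).continuous.mul (trigPoly φ).continuous).aestronglyMeasurable)
      ((integrable_circle _).norm.const_mul M)
      (fun N => Eventually.of_forall fun x => ?_) (Eventually.of_forall fun x => ?_)
    · rw [norm_mul]
      gcongr
      exact ((u N).norm_coe_le_norm x).trans (hM ⟨N, rfl⟩)
    · exact (((continuous_eval_const x).tendsto q).comp hlim).mul_const _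
  refine le_of_tendsto_of_tendsto' hint.norm (hlim.norm.const_mul (C : ℝ)) fun N => ?_
  rw [← hψ N]
  exact h.norm_integral_trigPoly_le (ψ N)

theorem trigNorm_le_of_isTorusBound {φ : ℤ →₀ ℂ} {C : ℝ≥0} (h : IsTorusBound 1 φ C) :
    trigNorm φ ≤ C := by
  have key : ∀ ε : ℝ, 0 < ε → ∫ x, ‖trigPoly φ x‖ ∂AddCircle.haarAddCircle ≤ C + ε := by
    intro ε hε
    have hden : ∀ x, 0 < ‖trigPoly φ x‖ + ε := fun x => by positivity
    -- A continuous substitute for the conjugate sign of `trigPoly φ`; the `ε` avoids division by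
    -- zero and costs at most `ε` in the integral.
    let q : C(UnitAddCircle, ℂ) :=
      ⟨fun x => (starRingEnd ℂ) (trigPoly φ x) / ((‖trigPoly φ x‖ + ε : ℝ) : ℂ), by
        refine Continuous.div (by fun_prop) (by fun_prop) fun x => ?_
        exact_mod_cast (hden x).ne'⟩
    have hq : ‖q‖ ≤ 1 := by
      rw [ContinuousMap.norm_le _ zero_le_one]
      intro x
      change ‖(starRingEnd ℂ) (trigPoly φ x) / ((‖trigPoly φ x‖ + ε : ℝ) : ℂ)‖ ≤ 1
      rw [norm_div, RCLike.norm_conj, Complex.norm_real, Real.norm_of_nonneg (hden x).le,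
        div_le_one (hden x)]
      linarith
    have hmul : ∀ x, q x * trigPoly φ x =
        ((‖trigPoly φ x‖ ^ 2 / (‖trigPoly φ x‖ + ε) : ℝ) : ℂ) := by
      intro x
      change (starRingEnd ℂ) (trigPoly φ x) / ((‖trigPoly φ x‖ + ε : ℝ) : ℂ) * trigPoly φ x = _
      rw [div_mul_eq_mul_div, Complex.conj_mul']
      push_cast
      rfl
    have h1 := h.norm_integral_mul_trigPoly_le q
    simp_rw [hmul] at h1
    rw [integral_complex_ofReal, Complex.norm_real] at h1
    have h2 : ∫ x, ‖trigPoly φ x‖ ^ 2 / (‖trigPoly φ x‖ + ε) ∂AddCircle.haarAddCircle ≤ C :=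
      (le_abs_self _).trans (h1.trans (mul_le_of_le_one_right C.2 hq))
    have hcont : Continuous fun x => ‖trigPoly φ x‖ ^ 2 / (‖trigPoly φ x‖ + ε) :=
      Continuous.div (by fun_prop) (by fun_prop) fun x => (hden x).ne'
    have h3 : ∫ x, ‖trigPoly φ x‖ ∂AddCircle.haarAddCircle ≤
        ∫ x, (‖trigPoly φ x‖ ^ 2 / (‖trigPoly φ x‖ + ε) + ε) ∂AddCircle.haarAddCircle := by
      refine integral_mono (integrable_circle _).norm
        ((hcont.integrable_of_hasCompactSupport (HasCompactSupport.of_compactSpace _)).add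
          (integrable_const _)) fun x => ?_
      have : ‖trigPoly φ x‖ ^ 2 / (‖trigPoly φ x‖ + ε) + ε - ‖trigPoly φ x‖ =
          ε ^ 2 / (‖trigPoly φ x‖ + ε) := by
        field_simp [(hden x).ne']
        ring
      have h0 : 0 ≤ ε ^ 2 / (‖trigPoly φ x‖ + ε) := div_nonneg (by positivity) (hden x).le
      change ‖trigPoly φ x‖ ≤ ‖trigPoly φ x‖ ^ 2 / (‖trigPoly φ x‖ + ε) + ε
      linarith
    rw [integral_add (hcont.integrable_of_hasCompactSupport (HasCompactSupport.of_compactSpace _))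
      (integrable_const _)] at h3
    simp only [integral_const, probReal_univ, one_smul] at h3
    linarith
  have := le_of_forall_pos_le_add key
  rw [trigNorm, ← ofReal_integral_norm_eq_lintegral_enorm (integrable_circle _)]
  rwa [ENNReal.ofReal_le_coe]

theorem torusNorm_one (φ : ℤ →₀ ℂ) : torusNorm 1 φ = trigNorm φ := by
  refine le_antisymm ((torusNorm_le (isTorusBound_one φ)).trans_eq
    (ENNReal.coe_toNNReal (trigNorm_lt_top φ).ne)) ?_
  exact le_torusNorm fun C hC => trigNorm_le_of_isTorusBound hC

theorem mem_torusMultiplier_one (φ : ℤ →₀ ℂ) : ⇑φ ∈ TorusMultiplier 1 := by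
  change torusNorm 1 φ < ∞
  rw [torusNorm_one]
  exact trigNorm_lt_top φ

/-! ### Periodization and the sufficient condition for `p = 1` -/

theorem lintegral_eq_lintegral_Ioc_tsum {f : ℝ → ℝ≥0∞} (hf : AEMeasurable f volume) :
    ∫⁻ x, f x = ∫⁻ x in Set.Ioc (0 : ℝ) 1, ∑' n : ℤ, f (x + n) := by
  have hU : (⋃ n : ℤ, Set.Ioc (n : ℝ) (n + 1)) = Set.univ := iUnion_Ioc_intCast ℝ
  have htr : ∀ n : ℤ, MeasurePreserving (fun x : ℝ => x + n) volume volume := fun n =>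
    measurePreserving_add_right volume (n : ℝ)
  have hm : ∀ n : ℤ, AEMeasurable (fun x : ℝ => f (x + n)) (volume.restrict (Set.Ioc 0 1)) :=
    fun n => (hf.comp_quasiMeasurePreserving (htr n).quasiMeasurePreserving).restrict
  rw [lintegral_tsum hm, ← setLIntegral_univ f, ← hU,
    lintegral_iUnion (fun n => measurableSet_Ioc) (Set.pairwise_disjoint_Ioc_intCast ℝ)]
  refine tsum_congr fun n => ?_
  rw [← (htr n).setLIntegral_comp_preimage_emb (measurableEmbedding_addRight (n : ℝ))]
  simp

theorem lintegral_Ioc_eq_lintegral_circle (t : ℝ) (f : UnitAddCircle → ℝ≥0∞) :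
    ∫⁻ x in Set.Ioc t (t + 1), f (x : UnitAddCircle) = ∫⁻ x, f x ∂AddCircle.haarAddCircle := by
  rw [UnitAddCircle.lintegral_preimage, AddCircle.volume_eq_smul_haarAddCircle,
    ENNReal.ofReal_one, one_smul]

theorem coe_add_intCast (x : ℝ) (n : ℤ) : ((x + n : ℝ) : UnitAddCircle) = x := by
  rw [AddCircle.coe_add, (AddCircle.coe_eq_zero_iff (1 : ℝ) (x := (n : ℝ))).2 ⟨n, by simp⟩,
    add_zero]

theorem fourier_coe_eq_fourierChar (n : ℤ) (x : ℝ) :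
    fourier n (x : UnitAddCircle) = (Real.fourierChar (n * x) : ℂ) := by
  rw [fourier_coe_apply, Real.fourierChar_apply]
  congr 1
  push_cast
  ring

theorem continuous_trigPoly_coe (φ : ℤ →₀ ℂ) :
    Continuous fun x : ℝ => trigPoly φ (x : UnitAddCircle) :=
  (trigPoly φ).continuous.comp (AddCircle.continuous_mk' 1)

theorem integrable_trigPoly_mul (φ : ℤ →₀ ℂ) {F : ℝ → ℂ} (hF : Integrable F) :
    Integrable fun x : ℝ => trigPoly φ (x : UnitAddCircle) * F x :=
  hF.bdd_mul (continuous_trigPoly_coe φ).aestronglyMeasurable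
    (Eventually.of_forall fun x => (trigPoly φ).norm_coe_le_norm x)

theorem fourier_fourier_mul (n : ℤ) (F : ℝ → ℂ) (ξ : ℝ) :
    𝓕 (fun x : ℝ => fourier n (x : UnitAddCircle) * F x) ξ = 𝓕 F (ξ - n) := by
  rw [Real.fourier_real_eq, Real.fourier_real_eq]
  refine integral_congr_ae (Eventually.of_forall fun x => ?_)
  simp only [fourier_coe_eq_fourierChar, Circle.smul_def, smul_eq_mul]
  rw [← mul_assoc, ← Circle.coe_mul, ← AddChar.map_add_eq_mul]
  congr 3
  ring

theorem fourier_trigPoly_mul (φ : ℤ →₀ ℂ) {F : ℝ → ℂ} (hF : Integrable F) (ξ : ℝ) :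
    𝓕 (fun x : ℝ => trigPoly φ (x : UnitAddCircle) * F x) ξ =
      ∑ n ∈ φ.support, φ n * 𝓕 F (ξ - n) := by
  simp_rw [← fourier_fourier_mul]
  rw [Real.fourier_real_eq]
  simp_rw [Real.fourier_real_eq, trigPoly_apply, ← integral_const_mul]
  rw [← integral_finsetSum]
  · refine integral_congr_ae (Eventually.of_forall fun x => ?_)
    simp only [Circle.smul_def, smul_eq_mul, Finset.sum_mul, Finset.mul_sum]
    refine Finset.sum_congr rfl fun n _ => ?_
    ring
  · intro n _
    refine Integrable.const_mul ?_ _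
    have : Integrable (fun x : ℝ => fourier n (x : UnitAddCircle) * F x) :=
      hF.bdd_mul (c := 1) ((fourier n).continuous.comp
        (AddCircle.continuous_mk' 1)).aestronglyMeasurable
        (Eventually.of_forall fun x => (norm_fourier_apply n _).le)
    exact this.bdd_mul (c := 1) (by fun_prop)
      (Eventually.of_forall fun x => (Circle.norm_coe _).le)

/-- The polynomial is constant on each fibre `x + ℤ`, so it factors out of the fibre sum, and what
remains is at most `delta F`. -/
theorem lintegral_enorm_trigPoly_mul_le (φ : ℤ →₀ ℂ) {F : ℝ → ℂ} (hF : Integrable F) :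
    ∫⁻ x : ℝ, ‖trigPoly φ (x : UnitAddCircle) * F x‖ₑ ≤ delta F * trigNorm φ := by
  rw [lintegral_eq_lintegral_Ioc_tsum (integrable_trigPoly_mul φ hF).1.enorm]
  have h := lintegral_Ioc_eq_lintegral_circle 0 fun x => ‖trigPoly φ x‖ₑ
  rw [zero_add] at h
  rw [trigNorm, ← h, ← lintegral_const_mul'' _
    (continuous_trigPoly_coe φ).enorm.measurable.aemeasurable]
  refine lintegral_mono_ae (ae_restrict_of_ae ?_)
  filter_upwards [delta_ae_le F] with x hx
  simp_rw [coe_add_intCast, enorm_mul]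
  rw [ENNReal.tsum_mul_left, mul_comm]
  gcongr

theorem lintegral_enorm_convolution_le {G f : ℝ → ℂ} (hG : Integrable G) (hf : Integrable f) :
    ∫⁻ x, ‖(convolution G f (ContinuousLinearMap.mul ℂ ℂ) volume) x‖ₑ ≤
      (∫⁻ x, ‖G x‖ₑ) * ∫⁻ x, ‖f x‖ₑ := by
  have hm := (hG.convolution_integrand (ContinuousLinearMap.mul ℂ ℂ) hf).1.enorm
  calc ∫⁻ x, ‖(convolution G f (ContinuousLinearMap.mul ℂ ℂ) volume) x‖ₑ
      ≤ ∫⁻ x, ∫⁻ t, ‖ContinuousLinearMap.mul ℂ ℂ (G t) (f (x - t))‖ₑ :=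
        lintegral_mono fun x => enorm_integral_le_lintegral_enorm _
    _ = ∫⁻ t, ∫⁻ x, ‖ContinuousLinearMap.mul ℂ ℂ (G t) (f (x - t))‖ₑ :=
        lintegral_lintegral_swap hm
    _ = ∫⁻ t, ‖G t‖ₑ * ∫⁻ x, ‖f x‖ₑ := by
        refine lintegral_congr fun t => ?_
        simp only [ContinuousLinearMap.mul_apply', enorm_mul]
        rw [lintegral_const_mul' _ _ enorm_ne_top, lintegral_sub_right_eq_self (fun x => ‖f x‖ₑ) t]
    _ = _ := lintegral_mul_const' _ _ hf.2.ne

/-- The Fourier transform of `G ∈ L¹(ℝ)` is a multiplier of `L¹(ℝ)` of norm at most `‖G‖₁`. -/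
theorem isLineBound_one_fourier {G : ℝ → ℂ} (hG : Integrable G) :
    IsLineBound 1 (𝓕 G) (∫⁻ x, ‖G x‖ₑ).toNNReal := by
  intro f hf
  have hfi := memLp_one_iff_integrable.1 hf
  -- The `L²` theory is used only for the existence of `g`; its `L¹` bound comes from identifying it
  -- with `G * f`.
  obtain ⟨g, hg, -⟩ := isLineBound_two (C := ⟨∫ y, ‖G y‖, by positivity⟩)
    (continuous_fourier hG).aestronglyMeasurable (Eventually.of_forall norm_fourier_le) f
    (Lp.memLp f)
  have hgh : g =ᵐ[volume] convolution G f (ContinuousLinearMap.mul ℂ ℂ) volume := by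
    refine ae_eq_of_fourierLp_ae_eq (hG.integrable_convolution _ hfi) (hg.trans ?_)
    filter_upwards [fourierLp_ae_eq_fourier hfi] with ξ hξ
    rw [hξ, Real.fourier_mul_convolution_eq hG hfi]
  refine ⟨g, hg, ?_⟩
  rw [eLpNorm_congr_ae hgh, eLpNorm_one_eq_lintegral_enorm, eLpNorm_one_eq_lintegral_enorm,
    ENNReal.coe_toNNReal hG.2.ne]
  exact lintegral_enorm_convolution_le hG hfi

theorem subset_finiteKernel_one :
    {Λ : ℝ → ℂ | ∃ F : ℝ → ℂ, Integrable F volume ∧ delta F < ∞ ∧ Λ =ᵐ[volume] 𝓕 F} ⊆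
      FiniteKernel 1 := by
  rintro Λ ⟨F, hF, hδ, hΛ⟩
  refine ⟨(memLp_congr_ae hΛ).2 (memLp_top_fourier hF), (delta F).toNNReal, fun φ _ => ?_⟩
  have hPF := integrable_trigPoly_mul φ hF
  have hW : (fun ξ : ℝ => ∑ n ∈ φ.support, φ n * Λ (ξ - n)) =ᵐ[volume]
      𝓕 (fun x : ℝ => trigPoly φ (x : UnitAddCircle) * F x) := by
    have : ∀ᵐ ξ : ℝ, ∀ n : ℤ, Λ (ξ - n) = 𝓕 F (ξ - n) := ae_all_iff.2 fun n =>
      (quasiMeasurePreserving_sub_const (n : ℝ)).ae hΛ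
    filter_upwards [this] with ξ hξ
    simp_rw [fourier_trigPoly_mul φ hF, hξ]
  have hle : lineNorm 1 (fun ξ : ℝ => ∑ n ∈ φ.support, φ n * Λ (ξ - n)) ≤
      delta F * trigNorm φ := by
    rw [lineNorm_congr hW]
    refine (lineNorm_le (isLineBound_one_fourier hPF)).trans ?_
    rw [ENNReal.coe_toNNReal hPF.2.ne]
    exact lintegral_enorm_trigPoly_mul_le φ hF
  refine ⟨⟨(memLp_congr_ae hW).2 (memLp_top_fourier hPF),
    hle.trans_lt (ENNReal.mul_lt_top hδ (trigNorm_lt_top φ))⟩, ?_⟩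
  rwa [torusNorm_one, ENNReal.coe_toNNReal hδ.ne]

/-! ### Necessity for `p = 1`: duality and Gaussian regularization -/

theorem memLp_two_of_bounded {f : ℝ → ℂ} (hf : Integrable f) {B : ℝ} (hB : ∀ x, ‖f x‖ ≤ B) :
    MemLp f 2 volume := by
  rw [memLp_two_iff_integrable_sq_norm hf.1]
  refine (hf.norm.const_mul B).mono' (hf.1.norm.pow 2) (Eventually.of_forall fun x => ?_)
  rw [Real.norm_of_nonneg (by positivity), pow_two]
  gcongr
  exact hB x

/-- The Gaussian approximate identity on `ℝ`. -/
noncomputable def gauss (j : ℕ) (x : ℝ) : ℂ :=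
  ((√((j : ℝ) + 1) * Real.exp (-(Real.pi * ((j : ℝ) + 1)) * x ^ 2) : ℝ) : ℂ)

theorem integrable_gauss (j : ℕ) : Integrable (gauss j) :=
  ((integrable_exp_neg_mul_sq (by positivity)).const_mul _).ofReal

theorem norm_gauss (j : ℕ) (x : ℝ) :
    ‖gauss j x‖ = √((j : ℝ) + 1) * Real.exp (-(Real.pi * ((j : ℝ) + 1)) * x ^ 2) := by
  rw [gauss, Complex.norm_real, Real.norm_of_nonneg (by positivity)]

theorem integral_norm_gauss (j : ℕ) : ∫ x, ‖gauss j x‖ = 1 := by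
  simp_rw [norm_gauss]
  rw [integral_const_mul, integral_gaussian, ← Real.sqrt_mul (by positivity)]
  rw [Real.sqrt_eq_one]
  field_simp

theorem memLp_two_gauss (j : ℕ) : MemLp (gauss j) 2 volume := by
  refine memLp_two_of_bounded (integrable_gauss j) (B := √((j : ℝ) + 1)) fun x => ?_
  rw [norm_gauss]
  refine mul_le_of_le_one_right (by positivity) (Real.exp_le_one_iff.2 ?_)
  have : 0 ≤ Real.pi * ((j : ℝ) + 1) * x ^ 2 := by positivity
  linarith

theorem fourier_gauss (j : ℕ) (ξ : ℝ) :
    𝓕 (gauss j) ξ = ((Real.exp (-(Real.pi / ((j : ℝ) + 1)) * ξ ^ 2) : ℝ) : ℂ) := by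
  have hj : (0 : ℝ) < (j : ℝ) + 1 := by positivity
  have h := congrFun (fourier_gaussian_pi (b := (((j : ℝ) + 1 : ℝ) : ℂ)) (by simpa using hj)) ξ
  have h2 : gauss j = fun x : ℝ => ((√((j : ℝ) + 1) : ℝ) : ℂ) *
      Complex.exp (-Real.pi * (((j : ℝ) + 1 : ℝ) : ℂ) * x ^ 2) := by
    ext x
    rw [gauss]
    push_cast
    congr 2
    ring
  have h3 : ((((j : ℝ) + 1 : ℝ) : ℂ)) ^ (1 / 2 : ℂ) = ((√((j : ℝ) + 1) : ℝ) : ℂ) := by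
    rw [Real.sqrt_eq_rpow, Complex.ofReal_cpow hj.le]
    norm_num
  have h4 : ((√((j : ℝ) + 1) : ℝ) : ℂ) ≠ 0 := by
    exact_mod_cast (Real.sqrt_pos.2 hj).ne'
  rw [h2]
  rw [Real.fourier_real_eq] at h ⊢
  simp_rw [Circle.smul_def, smul_eq_mul, mul_left_comm _ ((√((j : ℝ) + 1) : ℝ) : ℂ)] at h ⊢
  rw [integral_const_mul, h, h3, ← mul_assoc, mul_one_div_cancel h4, one_mul]
  push_cast
  congr 1
  ring

theorem integrable_fourier_gauss (j : ℕ) : Integrable (𝓕 (gauss j)) := by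
  have : 𝓕 (gauss j) = fun ξ : ℝ =>
      ((Real.exp (-(Real.pi / ((j : ℝ) + 1)) * ξ ^ 2) : ℝ) : ℂ) := funext (fourier_gauss j)
  rw [this]
  exact (integrable_exp_neg_mul_sq (by positivity)).ofReal

theorem norm_fourier_gauss_le (j : ℕ) (ξ : ℝ) : ‖𝓕 (gauss j) ξ‖ ≤ 1 :=
  (norm_fourier_le ξ).trans (integral_norm_gauss j).le

theorem tendsto_fourier_gauss (ξ : ℝ) :
    Tendsto (fun j => 𝓕 (gauss j) ξ) atTop (𝓝 1) := by
  simp_rw [fourier_gauss]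
  have h : Tendsto (fun j : ℕ => Real.exp (-(Real.pi / ((j : ℝ) + 1)) * ξ ^ 2)) atTop (𝓝 1) := by
    suffices Tendsto (fun j : ℕ => -(Real.pi / ((j : ℝ) + 1)) * ξ ^ 2) atTop (𝓝 0) by
      simpa only [Real.exp_zero, Function.comp_def] using (Real.continuous_exp.tendsto 0).comp this
    have := (tendsto_one_div_add_atTop_nhds_zero_nat (𝕜 := ℝ)).const_mul (-Real.pi * ξ ^ 2)
    rw [mul_zero] at this
    refine this.congr fun j => ?_
    ring
  simpa only [Complex.ofReal_one, Function.comp_def] using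
    (Complex.continuous_ofReal.tendsto 1).comp h

/-- Testing a multiplier of `L¹(ℝ)` against a Schwartz function, in duality. -/
theorem norm_integral_mul_fourierInv_le {W : ℝ → ℂ} (hW : MemLp W ∞ volume) {B : ℝ≥0}
    (h : lineNorm 1 W ≤ B) (ψ : SchwartzMap ℝ ℂ) {M : ℝ} (hM : ∀ x, ‖ψ x‖ ≤ M) :
    ‖∫ ξ, W ξ * 𝓕⁻ (ψ : ℝ → ℂ) ξ‖ ≤ B * M := by
  have hM0 : 0 ≤ M := (norm_nonneg _).trans (hM 0)
  have hψi : Integrable (𝓕⁻ (ψ : ℝ → ℂ)) := by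
    rw [← SchwartzMap.fourierInv_coe]
    exact (𝓕⁻ ψ).integrable
  obtain ⟨D, hD⟩ : ∃ D : ℝ, ∀ᵐ ξ : ℝ, ‖W ξ‖ ≤ D := by
    refine ⟨(eLpNorm W ∞ volume).toReal, ?_⟩
    filter_upwards [ae_le_eLpNormEssSup (f := W) (μ := volume)] with ξ hξ
    rw [← toReal_enorm]
    exact ENNReal.toReal_mono hW.2.ne (by simpa using hξ)
  have key : ∀ B' : ℝ≥0, B < B' → ‖∫ ξ, W ξ * 𝓕⁻ (ψ : ℝ → ℂ) ξ‖ ≤ B' * M := by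
    intro B' hB'
    have hb := isLineBound_of_lineNorm_lt (h.trans_lt (by exact_mod_cast hB'))
    have hlim : Tendsto (fun j => ∫ ξ, W ξ * 𝓕 (gauss j) ξ * 𝓕⁻ (ψ : ℝ → ℂ) ξ) atTop
        (𝓝 (∫ ξ, W ξ * 𝓕⁻ (ψ : ℝ → ℂ) ξ)) := by
      refine tendsto_integral_of_dominated_convergence (fun ξ => D * ‖𝓕⁻ (ψ : ℝ → ℂ) ξ‖)
        (fun j => (hW.1.mul (continuous_fourier (integrable_gauss j)).aestronglyMeasurable).mul
          hψi.1) (hψi.norm.const_mul D) (fun j => ?_) (Eventually.of_forall fun ξ => ?_)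
      · filter_upwards [hD] with ξ hξ
        rw [norm_mul, norm_mul]
        gcongr
        calc ‖W ξ‖ * ‖𝓕 (gauss j) ξ‖ ≤ ‖W ξ‖ * 1 := by
              gcongr
              exact norm_fourier_gauss_le j ξ
          _ ≤ D := by rwa [mul_one]
      · simpa using ((tendsto_fourier_gauss ξ).const_mul (W ξ)).mul_const (𝓕⁻ (ψ : ℝ → ℂ) ξ)
    refine le_of_tendsto' hlim.norm fun j => ?_
    -- The multiplier is applied to the Gaussian, of `L¹` norm `1`; the image `g` has norm at most
    -- `B'`, and its pairing with `ψ` is the regularized integral.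
    have hcoe := (memLp_two_gauss j).coeFn_toLp
    have hint : Integrable ((memLp_two_gauss j).toLp (gauss j)) :=
      (integrable_gauss j).congr hcoe.symm
    obtain ⟨g, hg1, hg2⟩ := hb ((memLp_two_gauss j).toLp (gauss j))
      (memLp_one_iff_integrable.2 hint)
    have hnorm : eLpNorm ((memLp_two_gauss j).toLp (gauss j)) 1 volume = 1 := by
      rw [eLpNorm_congr_ae hcoe, eLpNorm_one_eq_lintegral_enorm,
        ← ofReal_integral_norm_eq_lintegral_enorm (integrable_gauss j), integral_norm_gauss,
        ENNReal.ofReal_one]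
    rw [hnorm, mul_one] at hg2
    have hgi : Integrable g := memLp_one_iff_integrable.1
      ⟨Lp.aestronglyMeasurable g, hg2.trans_lt ENNReal.coe_lt_top⟩
    have hgB : ∫ x, ‖g x‖ ≤ B' := by
      rw [eLpNorm_one_eq_lintegral_enorm, ← ofReal_integral_norm_eq_lintegral_enorm hgi] at hg2
      rwa [ENNReal.ofReal_le_coe] at hg2
    have heq : ∫ ξ, W ξ * 𝓕 (gauss j) ξ * 𝓕⁻ (ψ : ℝ → ℂ) ξ = ∫ x, g x * ψ x := by
      conv_rhs => rw [← fourier_fourierInv_coe ψ, ← SchwartzMap.fourierInv_coe]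
      rw [← integral_fourierLp_mul, ← SchwartzMap.fourierInv_coe]
      refine integral_congr_ae ?_
      filter_upwards [hg1, fourierLp_ae_eq_fourier hint] with ξ h1 h2
      rw [h1, h2, Real.fourier_congr_ae hcoe]
    rw [heq]
    calc ‖∫ x, g x * ψ x‖ ≤ ∫ x, ‖g x‖ * M := by
          refine norm_integral_le_of_norm_le (hgi.norm.mul_const M)
            (Eventually.of_forall fun x => ?_)
          rw [norm_mul]
          gcongr
          exact hM x
      _ ≤ B' * M := by
          rw [integral_mul_const]
          gcongr
  have hlim : Tendsto (fun n : ℕ => ((B + 1 / ((n : ℝ≥0) + 1) : ℝ≥0) : ℝ) * M) atTop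
      (𝓝 (B * M)) := by
    have := ((tendsto_one_div_add_atTop_nhds_zero_nat (𝕜 := ℝ)).const_add (B : ℝ)).mul_const M
    simpa using this
  exact ge_of_tendsto' hlim fun n => key _ (lt_add_of_pos_right _ (by positivity))

theorem fourierInv_trigPoly_mul (φ : ℤ →₀ ℂ) {F : ℝ → ℂ} (hF : Integrable F) (ξ : ℝ) :
    𝓕⁻ (fun x : ℝ => trigPoly φ (x : UnitAddCircle) * F x) ξ =
      ∑ n ∈ φ.support, φ n * 𝓕⁻ F (ξ + n) := by
  rw [Real.fourierInv_eq_fourier_neg, fourier_trigPoly_mul φ hF]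
  refine Finset.sum_congr rfl fun n _ => ?_
  rw [Real.fourierInv_eq_fourier_neg]
  ring_nf

theorem integrable_mul_of_memLp_top {Λ u : ℝ → ℂ} (hΛ : MemLp Λ ∞ volume) (hu : Integrable u) :
    Integrable fun ξ => Λ ξ * u ξ :=
  hu.essSup_smul hΛ.1 hΛ.2.ne

theorem memLp_top_translate {Λ : ℝ → ℂ} (hΛ : MemLp Λ ∞ volume) (a : ℝ) :
    MemLp (fun ξ => Λ (ξ - a)) ∞ volume :=
  hΛ.comp_measurePreserving (measurePreserving_sub_right volume a)

theorem integrable_fourierInv_schwartz (ψ : SchwartzMap ℝ ℂ) : Integrable (𝓕⁻ (ψ : ℝ → ℂ)) := by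
  rw [← SchwartzMap.fourierInv_coe]
  exact (𝓕⁻ ψ).integrable

theorem integrable_fourierInv_trigPoly_mul (φ : ℤ →₀ ℂ) (ψ : SchwartzMap ℝ ℂ) :
    Integrable (𝓕⁻ fun x : ℝ => trigPoly φ (x : UnitAddCircle) * ψ x) := by
  have : 𝓕⁻ (fun x : ℝ => trigPoly φ (x : UnitAddCircle) * ψ x) = fun ξ =>
      ∑ n ∈ φ.support, φ n * 𝓕⁻ (ψ : ℝ → ℂ) (ξ + n) :=
    funext (fourierInv_trigPoly_mul φ ψ.integrable)
  rw [this]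
  exact integrable_finsetSum _ fun n _ =>
    ((integrable_fourierInv_schwartz ψ).comp_add_right (n : ℝ)).const_mul _

/-- Multiplying `ψ` by the polynomial superposes integer translates of `𝓕⁻ ψ`; a change of variable
in each term moves the translation onto `Λ`. -/
theorem integral_mul_fourierInv_trigPoly_mul {Λ : ℝ → ℂ} (hΛ : MemLp Λ ∞ volume) (φ : ℤ →₀ ℂ)
    (ψ : SchwartzMap ℝ ℂ) :
    ∫ ξ, Λ ξ * 𝓕⁻ (fun x : ℝ => trigPoly φ (x : UnitAddCircle) * ψ x) ξ =
      ∫ ξ, (∑ n ∈ φ.support, φ n * Λ (ξ - n)) * 𝓕⁻ (ψ : ℝ → ℂ) ξ := by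
  have hψi := integrable_fourierInv_schwartz ψ
  simp_rw [fourierInv_trigPoly_mul φ ψ.integrable, Finset.mul_sum, Finset.sum_mul]
  rw [integral_finsetSum, integral_finsetSum]
  · refine Finset.sum_congr rfl fun n _ => ?_
    rw [← integral_sub_right_eq_self _ (n : ℝ)]
    simp only [sub_add_cancel]
    refine integral_congr_ae (Eventually.of_forall fun ξ => ?_)
    ring
  · intro n _
    simp_rw [mul_assoc]
    exact (integrable_mul_of_memLp_top (memLp_top_translate hΛ n) hψi).const_mul _
  · intro n _
    exact integrable_mul_of_memLp_top hΛ ((hψi.comp_add_right (n : ℝ)).const_mul _)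

/-- A function `Λ` satisfying the defining inequality of `S₁⁰(ℝ)` with constant `C`. -/
def IsFiniteKernelBound (Λ : ℝ → ℂ) (C : ℝ≥0) : Prop :=
  ∀ φ : ℤ →₀ ℂ, (fun ξ : ℝ => ∑ n ∈ φ.support, φ n * Λ (ξ - n)) ∈ LineMultiplier 1 ∧
    lineNorm 1 (fun ξ : ℝ => ∑ n ∈ φ.support, φ n * Λ (ξ - n)) ≤ C * trigNorm φ

variable {Λ : ℝ → ℂ} {C : ℝ≥0}

theorem IsFiniteKernelBound.norm_integral_le (h : IsFiniteKernelBound Λ C)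
    (hΛ : MemLp Λ ∞ volume) (φ : ℤ →₀ ℂ) (ψ : SchwartzMap ℝ ℂ) {M : ℝ} (hM : ∀ x, ‖ψ x‖ ≤ M) :
    ‖∫ ξ, Λ ξ * 𝓕⁻ (fun x : ℝ => trigPoly φ (x : UnitAddCircle) * ψ x) ξ‖ ≤
      C * (trigNorm φ).toReal * M := by
  obtain ⟨h1, h2⟩ := h φ
  rw [integral_mul_fourierInv_trigPoly_mul hΛ]
  have := norm_integral_mul_fourierInv_le (B := C * (trigNorm φ).toNNReal) h1.1 (h2.trans_eq (by
    rw [ENNReal.coe_mul, ENNReal.coe_toNNReal (trigNorm_lt_top φ).ne])) ψ hM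
  rwa [NNReal.coe_mul] at this

theorem fourierInv_comp_add (u : ℝ → ℂ) (s ξ : ℝ) :
    𝓕⁻ (fun x => u (x + s)) ξ = Real.fourierChar (-(ξ * s)) • 𝓕⁻ u ξ := by
  rw [Real.fourierInv_eq, Real.fourierInv_eq, ← integral_sub_right_eq_self _ s, Circle.smul_def,
    ← integral_smul]
  refine integral_congr_ae (Eventually.of_forall fun x => ?_)
  simp only [sub_add_cancel, ← Circle.smul_def, smul_smul, ← AddChar.map_add_eq_mul]
  congr 2
  simp only [inner, RCLike.re_to_real, star_trivial]
  ring

/-- The trigonometric polynomial translated by `s`. -/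
theorem exists_trigPoly_translate (φ : ℤ →₀ ℂ) (s : UnitAddCircle) :
    ∃ φ' : ℤ →₀ ℂ, (∀ x, trigPoly φ' x = trigPoly φ (x + s)) ∧ trigNorm φ' = trigNorm φ := by
  let φ' : ℤ →₀ ℂ := Finsupp.onFinset φ.support (fun n => φ n * fourier n s) fun n hn => by
    rw [Finsupp.mem_support_iff]
    exact left_ne_zero_of_mul hn
  have h : ∀ x, trigPoly φ' x = trigPoly φ (x + s) := by
    intro x
    rw [trigPoly_apply_of_subset Finsupp.support_onFinset_subset, trigPoly_apply]
    refine Finset.sum_congr rfl fun n _ => ?_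
    change φ n * fourier n s * fourier n x = _
    simp only [fourier_apply, smul_add, AddCircle.toCircle_add, Circle.coe_mul]
    ring
  refine ⟨φ', h, ?_⟩
  simp_rw [trigNorm, h]
  exact lintegral_add_right_eq_self (fun x => ‖trigPoly φ x‖ₑ) s

/-- The inequality of `IsFiniteKernelBound.norm_integral_le` passes to a mollification of the
kernel. -/
theorem IsFiniteKernelBound.norm_integral_mollified_le (h : IsFiniteKernelBound Λ C)
    (hΛ : MemLp Λ ∞ volume) {k : ℝ → ℂ} (hk : Integrable k) (hk1 : ∫ x, ‖k x‖ ≤ 1)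
    (hkf : Integrable (𝓕 k)) (φ : ℤ →₀ ℂ) (ψ : SchwartzMap ℝ ℂ) {M : ℝ} (hM : ∀ x, ‖ψ x‖ ≤ M) :
    ‖∫ x, 𝓕⁻ (fun ξ => Λ ξ * 𝓕 k ξ) x * (trigPoly φ (x : UnitAddCircle) * ψ x)‖ ≤
      C * (trigNorm φ).toReal * M := by
  have hM0 : 0 ≤ M := (norm_nonneg _).trans (hM 0)
  set u : ℝ → ℂ := fun x => trigPoly φ (x : UnitAddCircle) * ψ x with hu
  have hui : Integrable u := integrable_trigPoly_mul φ ψ.integrable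
  have hΛu : Integrable fun ξ => Λ ξ * 𝓕⁻ u ξ :=
    integrable_mul_of_memLp_top hΛ (integrable_fourierInv_trigPoly_mul φ ψ)
  -- The mollified pairing is an average with weight `k`. Its value at `s` is the original pairing
  -- with `u (· + s)`, and translation changes neither `trigNorm φ` nor the bound `M`.
  have heq : ∫ x, 𝓕⁻ (fun ξ => Λ ξ * 𝓕 k ξ) x * u x =
      ∫ s, k s * 𝓕 (fun ξ => Λ ξ * 𝓕⁻ u ξ) s := by
    rw [integral_fourierInv_mul_swap (integrable_mul_of_memLp_top hΛ hkf) hui,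
      ← integral_fourier_mul_swap hk hΛu]
    refine integral_congr_ae (Eventually.of_forall fun ξ => ?_)
    ring
  have hb : ∀ s, ‖𝓕 (fun ξ => Λ ξ * 𝓕⁻ u ξ) s‖ ≤ C * (trigNorm φ).toReal * M := by
    intro s
    obtain ⟨φ', h1, h2⟩ := exists_trigPoly_translate φ (s : UnitAddCircle)
    have := h.norm_integral_le hΛ φ' (ψ.compSubConstCLM ℂ (-s)) (M := M) fun x => hM _
    rw [h2] at this
    refine le_trans (le_of_eq ?_) this
    congr 1
    rw [Real.fourier_real_eq]
    refine integral_congr_ae (Eventually.of_forall fun ξ => ?_)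
    have hus : (fun x : ℝ => trigPoly φ' (x : UnitAddCircle) * (ψ.compSubConstCLM ℂ (-s)) x) =
        fun x => u (x + s) := by
      ext x
      simp [hu, h1]
    simp only [hus, fourierInv_comp_add, Circle.smul_def, smul_eq_mul]
    ring
  rw [heq]
  calc ‖∫ s, k s * 𝓕 (fun ξ => Λ ξ * 𝓕⁻ u ξ) s‖
      ≤ ∫ s, ‖k s‖ * (C * (trigNorm φ).toReal * M) := by
        refine norm_integral_le_of_norm_le (hk.norm.mul_const _) (Eventually.of_forall fun s => ?_)
        rw [norm_mul]
        gcongr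
        exact hb s
    _ ≤ C * (trigNorm φ).toReal * M := by
        rw [integral_mul_const]
        exact mul_le_of_le_one_left (by positivity) hk1

/-! ### Localization to the fibres of `ℝ → 𝕋` -/

/-- On the interval of half-width `1/2` the only integer translate of `x₀` is `x₀` itself, so the
periodic peak has a unique maximum there. -/
theorem tendsto_peak_pow_line {u : ℝ → ℂ} (hu : Continuous u) (x₀ : ℝ) :
    Tendsto (fun N : ℕ =>
      (∫ y in Set.Icc (x₀ - 1 / 2) (x₀ + 1 / 2), peak ((y - x₀ : ℝ) : UnitAddCircle) ^ N)⁻¹ •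
        ∫ y in Set.Icc (x₀ - 1 / 2) (x₀ + 1 / 2),
          peak ((y - x₀ : ℝ) : UnitAddCircle) ^ N • u y) atTop (𝓝 (u x₀)) := by
  have hz : peak ((x₀ - x₀ : ℝ) : UnitAddCircle) = 1 := by simp [peak_zero]
  refine tendsto_setIntegral_pow_smul_of_unique_maximum_of_isCompact_of_continuousOn isCompact_Icc
    (c := fun y : ℝ => peak ((y - x₀ : ℝ) : UnitAddCircle)) ?_ (fun y hy hne => ?_)
    (fun y _ => peak_nonneg _) (by rw [hz]; exact one_pos) ?_ hu.continuousOn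
  · exact (continuous_peak.comp ((AddCircle.continuous_mk' 1).comp
      (continuous_id.sub continuous_const))).continuousOn
  · rw [hz]
    refine peak_lt_one fun h => hne ?_
    obtain ⟨n, hn⟩ := (AddCircle.coe_eq_zero_iff (1 : ℝ)).1 h
    rw [zsmul_eq_mul, mul_one] at hn
    have h1 : (n : ℝ) < 1 := by linarith [hy.2]
    have h2 : (-1 : ℝ) < n := by linarith [hy.1]
    have h3 : n < 1 := by exact_mod_cast h1
    have h4 : -1 < n := by exact_mod_cast h2
    have : n = 0 := by lia
    rw [this, Int.cast_zero] at hn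
    linarith
  · rw [interior_Icc, closure_Ioo (by linarith)]
    constructor <;> linarith

theorem continuous_fourierInv {h : ℝ → ℂ} (hh : Integrable h) : Continuous (𝓕⁻ h) := by
  rw [Real.fourierInv_eq_fourier_comp_neg]
  exact continuous_fourier hh.comp_neg

/-- A sum of integer translates of a bump supported in an interval of length one. -/
theorem norm_sum_translates_le (b : ℝ → ℝ) (x₀ : ℝ) (hb : ∀ y, |b y| ≤ 1)
    (hsupp : ∀ y, 1 / 2 ≤ |y - x₀| → b y = 0) (s : Finset ℤ) {c : ℤ → ℂ} (hc : ∀ n, ‖c n‖ ≤ 1)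
    (y : ℝ) : ‖∑ n ∈ s, c n * (b (y - n) : ℂ)‖ ≤ 1 := by
  by_cases h : ∃ n ∈ s, b (y - n) ≠ 0
  · obtain ⟨n, hn, hne⟩ := h
    have h1 : |y - n - x₀| < 1 / 2 := by
      by_contra hcon
      exact hne (hsupp _ (not_lt.1 hcon))
    rw [Finset.sum_eq_single_of_mem n hn]
    · rw [norm_mul, Complex.norm_real]
      exact mul_le_one₀ (hc n) (norm_nonneg _) (hb _)
    · intro m _ hmn
      rw [hsupp, Complex.ofReal_zero, mul_zero]
      by_contra hcon
      rw [not_le, abs_lt] at hcon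
      rw [abs_lt] at h1
      have h2 : ((m - n : ℤ) : ℝ) < 1 := by push_cast; linarith [h1.1, hcon.1, h1.2, hcon.2]
      have h3 : ((-1 : ℤ) : ℝ) < ((m - n : ℤ) : ℝ) := by
        push_cast
        linarith [h1.1, hcon.1, h1.2, hcon.2]
      have h4 : m - n < 1 := by exact_mod_cast h2
      have h5 : -1 < m - n := by exact_mod_cast h3
      exact hmn (by lia)
  · push Not at h
    rw [Finset.sum_eq_zero fun n hn => by rw [h n hn, Complex.ofReal_zero, mul_zero]]
    simp

/-- If a continuous `g` pairs with products of trigonometric polynomials and bounded functions like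
an element of the dual of `L¹(𝕋; c₀(ℤ))`, then its fibres over `𝕋` are bounded in `ℓ¹(ℤ)`. -/
theorem sum_norm_le_of_pairing {g : ℝ → ℂ} (hg : Continuous g)
    (H : ∀ (φ : ℤ →₀ ℂ) (ψ : SchwartzMap ℝ ℂ), (∀ x, ‖ψ x‖ ≤ 1) →
      ‖∫ x, g x * (trigPoly φ (x : UnitAddCircle) * ψ x)‖ ≤ C * (trigNorm φ).toReal)
    (x₀ : ℝ) (s : Finset ℤ) : ∑ n ∈ s, ‖g (x₀ + n)‖ ≤ C := by
  -- The conjugate phase of `g (x₀ + n)`; where `g` vanishes, division by zero gives `0` and `hcg`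
  -- still holds.
  let c : ℤ → ℂ := fun n => (starRingEnd ℂ) (g (x₀ + n)) / (‖g (x₀ + n)‖ : ℂ)
  have hc : ∀ n, ‖c n‖ ≤ 1 := fun n => by
    simp only [c, norm_div, RCLike.norm_conj, Complex.norm_real, norm_norm]
    exact div_self_le_one _
  have hcg : ∀ n, c n * g (x₀ + n) = (‖g (x₀ + n)‖ : ℂ) := fun n => by
    simp only [c]
    rw [div_mul_eq_mul_div, Complex.conj_mul', pow_two, mul_self_div_self]
  -- Outer radius `1/2` makes the integer translates of the bump disjointly supported, so `ψ` keeps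
  -- sup norm at most `1` however many terms `s` has.
  let b : ContDiffBump x₀ := ⟨1 / 4, 1 / 2, by norm_num, by norm_num⟩
  have hbsupp : ∀ y, 1 / 2 ≤ |y - x₀| → b y = 0 := fun y hy => b.zero_of_le_dist hy
  have hbone : b x₀ = 1 := b.one_of_mem_closedBall (Metric.mem_closedBall_self (by norm_num))
  have hbc : Continuous b := b.continuous
  have hbcs : HasCompactSupport fun y => (b y : ℂ) := b.hasCompactSupport.comp_left
    Complex.ofReal_zero
  let f : ℝ → ℂ := fun y => ∑ n ∈ s, c n * (b (y - n) : ℂ)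
  have hfs : ContDiff ℝ ((⊤ : ℕ∞) : WithTop ℕ∞) f := by
    refine ContDiff.sum fun n _ => contDiff_const.mul (Complex.ofRealCLM.contDiff.comp ?_)
    exact b.contDiff.comp (contDiff_id.sub contDiff_const)
  have hfc : HasCompactSupport f := by
    refine HasCompactSupport.of_support_subset_isCompact
      (K := ⋃ n ∈ s, Set.Icc (x₀ - 1 / 2 + n) (x₀ + 1 / 2 + n))
      (s.finite_toSet.isCompact_biUnion fun n _ => isCompact_Icc) fun y hy => ?_
    obtain ⟨n, hn, hne⟩ := Finset.exists_ne_zero_of_sum_ne_zero hy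
    have hb : b (y - n) ≠ 0 := fun h0 => hne (by rw [h0, Complex.ofReal_zero, mul_zero])
    have h1 : |y - n - x₀| < 1 / 2 := by
      by_contra hcon
      exact hb (hbsupp _ (not_lt.1 hcon))
    rw [abs_lt] at h1
    simp only [Set.mem_iUnion, exists_prop]
    exact ⟨n, hn, by constructor <;> linarith [h1.1, h1.2]⟩
  let ψ : SchwartzMap ℝ ℂ := hfc.toSchwartzMap hfs
  have hψ : ∀ x, ψ x = f x := fun x => rfl
  have hψ1 : ∀ x, ‖ψ x‖ ≤ 1 := fun x => norm_sum_translates_le b x₀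
    (fun y => by rw [abs_of_nonneg b.nonneg]; exact b.le_one) hbsupp s hc x
  -- Periodicity of the polynomial folds all translates of the bump back to `x₀`, moving the shifts
  -- onto `g`. At `x₀` the phases make `G` the desired sum.
  let G : ℝ → ℂ := fun y => (b y : ℂ) * ∑ n ∈ s, c n * g (y + n)
  have hG : Continuous G := by fun_prop
  have hG0 : G x₀ = ((∑ n ∈ s, ‖g (x₀ + n)‖ : ℝ) : ℂ) := by
    simp only [G, hbone, hcg]
    push_cast
    ring
  set S := Set.Icc (x₀ - 1 / 2) (x₀ + 1 / 2) with hS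
  have hbound : ∀ N : ℕ, ‖∫ y in S, peak ((y - x₀ : ℝ) : UnitAddCircle) ^ N • G y‖ ≤
      C * ∫ y in S, peak ((y - x₀ : ℝ) : UnitAddCircle) ^ N := by
    intro N
    obtain ⟨φ, hφ⟩ := exists_trigPoly_peak (x₀ : UnitAddCircle) N
    -- The polynomial is nonnegative, so its `L¹` norm is exactly the normalizing integral of the
    -- peak.
    have hnorm : (trigNorm φ).toReal = ∫ y in S, peak ((y - x₀ : ℝ) : UnitAddCircle) ^ N := by
      have h1 := lintegral_Ioc_eq_lintegral_circle (x₀ - 1 / 2) fun x => ‖trigPoly φ x‖ₑ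
      have h2 : x₀ - 1 / 2 + 1 = x₀ + 1 / 2 := by ring
      rw [h2] at h1
      rw [trigNorm, ← h1, hS, integral_Icc_eq_integral_Ioc, ← integral_norm_eq_lintegral_enorm
        (continuous_trigPoly_coe φ).aestronglyMeasurable]
      refine integral_congr_ae (Eventually.of_forall fun y => ?_)
      simp only [hφ, Complex.norm_real]
      rw [Real.norm_of_nonneg (pow_nonneg (peak_nonneg _) N), AddCircle.coe_sub]
    have hterm : ∀ n : ℤ, Continuous fun y : ℝ =>
        g (y + n) * (trigPoly φ (y : UnitAddCircle) * (b y : ℂ)) := fun n => by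
      have := continuous_trigPoly_coe φ
      fun_prop
    have hint : ∀ n : ℤ, Integrable fun y : ℝ =>
        g (y + n) * (trigPoly φ (y : UnitAddCircle) * (b y : ℂ)) := fun n =>
      (hterm n).integrable_of_hasCompactSupport (hbcs.mul_left.mul_left)
    have heq : ∫ x, g x * (trigPoly φ (x : UnitAddCircle) * ψ x) =
        ∫ y in S, peak ((y - x₀ : ℝ) : UnitAddCircle) ^ N • G y := by
      calc ∫ x, g x * (trigPoly φ (x : UnitAddCircle) * ψ x)
          = ∑ n ∈ s, c n * ∫ y, g (y + n) * (trigPoly φ (y : UnitAddCircle) * (b y : ℂ)) := by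
            have hsh : ∀ n : ℤ, ∀ x : ℝ, g (x - n + n) *
                (trigPoly φ ((x - n : ℝ) : UnitAddCircle) * (b (x - n) : ℂ)) =
                g x * (trigPoly φ (x : UnitAddCircle) * (b (x - n) : ℂ)) := fun n x => by
              have := coe_add_intCast x (-n)
              rw [Int.cast_neg, ← sub_eq_add_neg] at this
              rw [sub_add_cancel, this]
            simp_rw [hψ, f, Finset.mul_sum]
            rw [integral_finsetSum]
            · refine Finset.sum_congr rfl fun n _ => ?_
              rw [← integral_const_mul]
              conv_rhs => rw [← integral_sub_right_eq_self _ (n : ℝ)]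
              refine integral_congr_ae (Eventually.of_forall fun x => ?_)
              simp only [hsh]
              ring
            · intro n _
              refine (((hint n).comp_sub_right (n : ℝ)).const_mul (c n)).congr
                (Eventually.of_forall fun x => ?_)
              simp only [hsh]
              ring
        _ = ∫ y : ℝ, trigPoly φ (y : UnitAddCircle) * G y := by
            simp_rw [← integral_const_mul]
            rw [← integral_finsetSum _ fun n _ => (hint n).const_mul _]
            refine integral_congr_ae (Eventually.of_forall fun y => ?_)
            simp only [G, Finset.mul_sum]
            refine Finset.sum_congr rfl fun n _ => ?_
            ring
        _ = ∫ y in S, trigPoly φ (y : UnitAddCircle) * G y := by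
            refine (setIntegral_eq_integral_of_forall_compl_eq_zero fun y hy => ?_).symm
            have : b y = 0 := by
              refine hbsupp y ?_
              by_contra hcon
              rw [not_le, abs_lt] at hcon
              exact hy ⟨by linarith [hcon.1], by linarith [hcon.2]⟩
            simp [G, this]
        _ = _ := by
            refine integral_congr_ae (Eventually.of_forall fun y => ?_)
            simp only [hφ, AddCircle.coe_sub, Complex.real_smul]
    rw [← heq, ← hnorm]
    exact H φ ψ hψ1
  have hlim := (tendsto_peak_pow_line hG x₀).norm
  have hG0' : ‖G x₀‖ = ∑ n ∈ s, ‖g (x₀ + n)‖ := by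
    rw [hG0, Complex.norm_real, Real.norm_of_nonneg (Finset.sum_nonneg fun n _ => norm_nonneg _)]
  rw [← hG0']
  refine le_of_tendsto' hlim fun N => ?_
  have hI : 0 ≤ ∫ y in S, peak ((y - x₀ : ℝ) : UnitAddCircle) ^ N :=
    integral_nonneg fun y => pow_nonneg (peak_nonneg _) N
  rw [norm_smul, norm_inv, Real.norm_of_nonneg hI]
  refine (mul_le_mul_of_nonneg_left (hbound N) (inv_nonneg.2 hI)).trans ?_
  rw [mul_left_comm]
  exact mul_le_of_le_one_right C.2 (inv_mul_le_one)

/-! ### Removal of the regularization -/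

theorem eLpNorm_two_sq (f : ℝ → ℂ) :
    eLpNorm f 2 volume ^ 2 = ∫⁻ x, ‖f x‖ₑ ^ 2 := by
  have := eLpNorm_nnreal_pow_eq_lintegral (f := f) (μ := (volume : Measure ℝ)) (p := 2) two_ne_zero
  simpa using this

theorem tsum_sq_le_sq_tsum (a : ℤ → ℝ≥0∞) : ∑' n, a n ^ 2 ≤ (∑' n, a n) ^ 2 := by
  rw [pow_two (∑' n, a n), ← ENNReal.tsum_mul_right]
  refine ENNReal.tsum_le_tsum fun n => ?_
  rw [pow_two]
  gcongr
  exact ENNReal.le_tsum n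

/-- On each fibre the `ℓ²` norm is at most the `ℓ¹` norm, and the base has measure `1`. -/
theorem eLpNorm_two_le_of_tsum_le {g : ℝ → ℂ} (hg : AEStronglyMeasurable g volume) {C : ℝ≥0∞}
    (h : ∀ᵐ x : ℝ, ∑' n : ℤ, ‖g (x + n)‖ₑ ≤ C) : eLpNorm g 2 volume ≤ C := by
  rw [← ENNReal.pow_le_pow_left_iff two_ne_zero, eLpNorm_two_sq,
    lintegral_eq_lintegral_Ioc_tsum (hg.enorm.pow_const 2)]
  calc ∫⁻ x in Set.Ioc (0 : ℝ) 1, ∑' n : ℤ, ‖g (x + n)‖ₑ ^ 2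
      ≤ ∫⁻ _ in Set.Ioc (0 : ℝ) 1, C ^ 2 := by
        refine lintegral_mono_ae (ae_restrict_of_ae ?_)
        filter_upwards [h] with x hx
        exact (tsum_sq_le_sq_tsum _).trans (by gcongr)
    _ = C ^ 2 := by simp

theorem fourierInvLp_ae_eq_fourierInv {f : Lp ℂ 2 (volume : Measure ℝ)} (hf : Integrable f) :
    (𝓕⁻ f : Lp ℂ 2 (volume : Measure ℝ)) =ᵐ[volume] 𝓕⁻ (f : ℝ → ℂ) := by
  refine ae_eq_of_integral_schwartz_mul ((Lp.memLp _).locallyIntegrable (by norm_num))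
    (continuous_fourierInv hf).locallyIntegrable fun ψ => ?_
  have h := integral_fourierLp_mul (𝓕⁻ f) (𝓕⁻ ψ)
  rw [FourierTransform.fourier_fourierInv_eq, SchwartzMap.fourierInv_coe,
    fourier_fourierInv_coe] at h
  rw [← h, integral_fourierInv_mul_swap hf ψ.integrable]

theorem norm_fourierInvLp (f : Lp ℂ 2 (volume : Measure ℝ)) :
    ‖(𝓕⁻ f : Lp ℂ 2 (volume : Measure ℝ))‖ = ‖f‖ := by
  rw [← Lp.norm_fourier_eq, FourierTransform.fourier_fourierInv_eq]

theorem IsFiniteKernelBound.tsum_enorm_le (h : IsFiniteKernelBound Λ C)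
    (hΛ : MemLp Λ ∞ volume) (j : ℕ) (x : ℝ) :
    ∑' n : ℤ, ‖𝓕⁻ (fun ξ => Λ ξ * 𝓕 (gauss j) ξ) (x + n)‖ₑ ≤ C := by
  have hs := sum_norm_le_of_pairing (C := C) (continuous_fourierInv
    (integrable_mul_of_memLp_top hΛ (integrable_fourier_gauss j))) (fun φ ψ hψ => by
      simpa using h.norm_integral_mollified_le hΛ (integrable_gauss j) (integral_norm_gauss j).le
        (integrable_fourier_gauss j) φ ψ hψ) x
  refine ENNReal.summable.tsum_le_of_sum_le fun s => ?_
  have := hs s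
  simp only [enorm_eq_nnnorm]
  simp only [← coe_nnnorm] at this
  exact_mod_cast this

theorem memLp_two_fourier_gauss (j : ℕ) : MemLp (𝓕 (gauss j)) 2 volume :=
  memLp_two_of_bounded (integrable_fourier_gauss j) (norm_fourier_gauss_le j)

theorem memLp_two_mul_fourier_gauss (hΛ : MemLp Λ ∞ volume) (j : ℕ) :
    MemLp (fun ξ => Λ ξ * 𝓕 (gauss j) ξ) 2 volume :=
  (memLp_two_fourier_gauss j).mul hΛ

theorem fourierInvLp_toLp_ae_eq (hΛ : MemLp Λ ∞ volume) (j : ℕ) :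
    (𝓕⁻ ((memLp_two_mul_fourier_gauss hΛ j).toLp _) : Lp ℂ 2 (volume : Measure ℝ)) =ᵐ[volume]
      𝓕⁻ (fun ξ => Λ ξ * 𝓕 (gauss j) ξ) := by
  have hcoe := (memLp_two_mul_fourier_gauss hΛ j).coeFn_toLp
  refine (fourierInvLp_ae_eq_fourierInv ((integrable_mul_of_memLp_top hΛ
    (integrable_fourier_gauss j)).congr hcoe.symm)).trans (Eventually.of_forall fun x => ?_)
  exact Real.fourierInv_congr_ae hcoe x

/-- By Plancherel the regularized multipliers have `L²` norm at most `C`, uniformly in `j`; they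
converge pointwise to `Λ`, so Fatou applies. -/
theorem IsFiniteKernelBound.memLp_two (h : IsFiniteKernelBound Λ C)
    (hΛ : MemLp Λ ∞ volume) : MemLp Λ 2 volume := by
  refine ⟨hΛ.1, lt_of_le_of_lt ?_ (ENNReal.coe_lt_top (r := C))⟩
  refine Lp.eLpNorm_le_of_ae_tendsto (u := atTop) (f := fun (j : ℕ) ξ => Λ ξ * 𝓕 (gauss j) ξ)
    (Eventually.of_forall fun j => ?_) (fun j => (memLp_two_mul_fourier_gauss hΛ j).1)
    (Eventually.of_forall fun ξ => ?_)
  · rw [← Lp.enorm_toLp (memLp_two_mul_fourier_gauss hΛ j), ← ofReal_norm, ← norm_fourierInvLp,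
      ofReal_norm, Lp.enorm_def, eLpNorm_congr_ae (fourierInvLp_toLp_ae_eq hΛ j)]
    exact eLpNorm_two_le_of_tsum_le (continuous_fourierInv (integrable_mul_of_memLp_top hΛ
      (integrable_fourier_gauss j))).aestronglyMeasurable
      (Eventually.of_forall (h.tsum_enorm_le hΛ j))
  · simpa using (tendsto_fourier_gauss ξ).const_mul (Λ ξ)

theorem tendsto_eLpNorm_mul_fourier_gauss_sub (h2 : MemLp Λ 2 volume) :
    Tendsto (fun j => eLpNorm (fun ξ => Λ ξ * 𝓕 (gauss j) ξ - Λ ξ) 2 volume) atTop (𝓝 0) := by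
  have hmeas : ∀ j, AEStronglyMeasurable (fun ξ => Λ ξ * 𝓕 (gauss j) ξ - Λ ξ) volume := fun j =>
    (h2.1.mul (continuous_fourier (integrable_gauss j)).aestronglyMeasurable).sub h2.1
  have hsq : Tendsto (fun j => ∫⁻ ξ, ‖Λ ξ * 𝓕 (gauss j) ξ - Λ ξ‖ₑ ^ 2) atTop
      (𝓝 (∫⁻ _ : ℝ, 0)) := by
    refine tendsto_lintegral_of_dominated_convergence' (fun ξ => 4 * ‖Λ ξ‖ₑ ^ 2)
      (fun j => (hmeas j).enorm.pow_const 2) (fun j => Eventually.of_forall fun ξ => ?_) ?_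
      (Eventually.of_forall fun ξ => ?_)
    · have h1 : ‖Λ ξ * 𝓕 (gauss j) ξ - Λ ξ‖ₑ ≤ 2 * ‖Λ ξ‖ₑ := by
        have : ‖Λ ξ * 𝓕 (gauss j) ξ - Λ ξ‖ ≤ 2 * ‖Λ ξ‖ := by
          refine (norm_sub_le _ _).trans ?_
          rw [norm_mul]
          have := mul_le_of_le_one_right (norm_nonneg (Λ ξ)) (norm_fourier_gauss_le j ξ)
          linarith
        rw [← ofReal_norm, ← ofReal_norm]
        refine (ENNReal.ofReal_le_ofReal this).trans_eq ?_
        rw [ENNReal.ofReal_mul zero_le_two, ENNReal.ofReal_ofNat]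
      refine (pow_le_pow_left' h1 2).trans_eq ?_
      rw [mul_pow]
      norm_num
    · rw [lintegral_const_mul'' _ (h2.1.enorm.pow_const 2), ← eLpNorm_two_sq]
      exact ENNReal.mul_ne_top (by norm_num) (ENNReal.pow_ne_top h2.2.ne)
    · have := ((tendsto_fourier_gauss ξ).const_mul (Λ ξ)).sub_const (Λ ξ)
      rw [mul_one, sub_self] at this
      have h3 := (ENNReal.continuous_pow 2).tendsto _ |>.comp this.enorm
      simpa [Function.comp_def] using h3
  rw [lintegral_zero] at hsq
  simp_rw [← eLpNorm_two_sq] at hsq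
  have := hsq.ennrpow_const (1 / 2)
  rw [ENNReal.zero_rpow_of_pos (by norm_num)] at this
  refine this.congr fun j => ?_
  rw [← ENNReal.rpow_natCast, ← ENNReal.rpow_mul]
  norm_num

/-- A bounded `Λ` obeying the inequality of `S₁⁰(ℝ)` with constant `C` is the Fourier transform of
an integrable `F` with `δ_F ≤ C`. -/
theorem IsFiniteKernelBound.exists_fourier_eq (h : IsFiniteKernelBound Λ C)
    (hΛ : MemLp Λ ∞ volume) :
    ∃ F : ℝ → ℂ, Integrable F volume ∧ delta F ≤ C ∧ Λ =ᵐ[volume] 𝓕 F := by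
  have h2 := h.memLp_two hΛ
  set F : Lp ℂ 2 (volume : Measure ℝ) := 𝓕⁻ (h2.toLp Λ) with hF
  let G : ℕ → Lp ℂ 2 (volume : Measure ℝ) := fun j =>
    𝓕⁻ ((memLp_two_mul_fourier_gauss hΛ j).toLp _)
  have hGF : Tendsto (fun j => eLpNorm (⇑(G j) - ⇑F) 2 volume) atTop (𝓝 0) := by
    refine (tendsto_eLpNorm_mul_fourier_gauss_sub h2).congr fun j => ?_
    have h3 : G j - F = 𝓕⁻ ((memLp_two_mul_fourier_gauss hΛ j).toLp _ - h2.toLp Λ) :=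
      (map_sub (Lp.fourierTransformₗᵢ ℝ ℂ).symm _ _).symm
    rw [← eLpNorm_congr_ae (Lp.coeFn_sub (G j) F), ← Lp.enorm_def, h3, ← ofReal_norm,
      norm_fourierInvLp, ofReal_norm, ← MemLp.toLp_sub, Lp.enorm_toLp]
    rfl
  obtain ⟨ns, -, hns⟩ := (tendstoInMeasure_of_tendsto_eLpNorm two_ne_zero
    (fun j => Lp.aestronglyMeasurable (G j)) (Lp.aestronglyMeasurable F) hGF).exists_seq_tendsto_ae
  have hae : ∀ᵐ x : ℝ, Tendsto (fun i => 𝓕⁻ (fun ξ => Λ ξ * 𝓕 (gauss (ns i)) ξ) x) atTop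
      (𝓝 (F x)) := by
    filter_upwards [hns, ae_all_iff.2 fun j => fourierInvLp_toLp_ae_eq hΛ j] with x h3 h4
    exact h3.congr fun i => h4 (ns i)
  have hall : ∀ᵐ x : ℝ, ∀ n : ℤ, Tendsto
      (fun i => 𝓕⁻ (fun ξ => Λ ξ * 𝓕 (gauss (ns i)) ξ) (x + n)) atTop (𝓝 (F (x + n))) :=
    ae_all_iff.2 fun n =>
      (measurePreserving_add_right volume (n : ℝ)).quasiMeasurePreserving.ae hae
  -- Finite partial sums pass to the limit along the subsequence. Integrating the resulting fibre
  -- bound over a period then puts `F` in `L¹`.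
  have hsum : ∀ᵐ x : ℝ, ∑' n : ℤ, ‖F (x + n)‖ₑ ≤ C := by
    filter_upwards [hall] with x hx
    refine ENNReal.summable.tsum_le_of_sum_le fun s => ?_
    refine le_of_tendsto' (tendsto_finsetSum s fun n _ => (hx n).enorm) fun i => ?_
    exact (ENNReal.sum_le_tsum s).trans (h.tsum_enorm_le hΛ (ns i) x)
  have hFi : Integrable F := by
    refine ⟨Lp.aestronglyMeasurable F, ?_⟩
    rw [HasFiniteIntegral, lintegral_eq_lintegral_Ioc_tsum (Lp.aestronglyMeasurable F).enorm]
    refine (lintegral_mono_ae (ae_restrict_of_ae hsum)).trans_lt ?_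
    simp
  refine ⟨F, hFi, essSup_le_of_ae_le _ hsum, ?_⟩
  have h5 := fourierLp_ae_eq_fourier hFi
  rw [hF, FourierTransform.fourier_fourierInv_eq] at h5
  exact h2.coeFn_toLp.symm.trans h5

theorem finiteKernel_one_subset :
    FiniteKernel 1 ⊆
      {Λ : ℝ → ℂ | ∃ F : ℝ → ℂ, Integrable F volume ∧ delta F < ∞ ∧ Λ =ᵐ[volume] 𝓕 F} := by
  rintro Λ ⟨hΛ, C, hC⟩
  have h : IsFiniteKernelBound Λ C := fun φ => by
    rw [← torusNorm_one]
    exact hC φ (mem_torusMultiplier_one φ)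
  obtain ⟨F, h1, h2, h3⟩ := h.exists_fourier_eq hΛ
  exact ⟨F, h1, h2.trans_lt ENNReal.coe_lt_top, h3⟩

end SummabilityKernel

theorem theorem2p1 :
    (SummabilityKernel.FiniteKernel 2 = SummabilityKernel.Kernel 2 ∧
      SummabilityKernel.Kernel 2 =
        {Λ : ℝ → ℂ | MemLp Λ ∞ volume ∧ SummabilityKernel.delta Λ < ∞}) ∧
    SummabilityKernel.FiniteKernel 1 =
      {Λ : ℝ → ℂ | ∃ F : ℝ → ℂ, Integrable F volume ∧ SummabilityKernel.delta F < ∞ ∧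
        Λ =ᵐ[volume] 𝓕 F} :=
  ⟨SummabilityKernel.two_eq, SummabilityKernel.finiteKernel_one_subset.antisymm
    SummabilityKernel.subset_finiteKernel_one⟩
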